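/- Let $M$ be a complex manifold of complex dimension $2$ with holomorphic tangent bundle $T'M$, and let $(M,F)$ be a complex Finsler space: $F:T'M\to[0,\infty)$ is continuous, $L:=F^2$ is smooth away from the zero section, $F(z,\eta)=0$ iff $\eta=0$, $F(z,c\eta)=|c|F(z,\eta)$ for all $c\in\mathbb C$, and, in local holomorphic coordinates $(z^k,\eta^k)$ of $T'M$, the Hermitian matrix of $g_{i\bar j}:=\partial^2L/\partial\eta^i\partial\bar\eta^j$ is positive definite for $\eta\ne0$. Let $(g^{\bar m i})$ be the inverse matrix, $\dot\partial_k:=\partial/\partial\eta^k$, and sum over repeated indices. The Chern-Finsler connection has the coefficients $$N^k_j=g^{\bar m k}\frac{\partial g_{l\bar m}}{\partial z^j}\eta^l,\quad \delta_k=\frac{\partial}{\partial z^k}-N^j_k\dot\partial_j,\quad L^i_{jk}=g^{\bar l i}\delta_kg_{j\bar l},\quad C^i_{jk}=g^{\bar l i}\dot\partial_kg_{j\bar l}.$$ Put $G^i=\tfrac12N^i_j\eta^j$, $\overset{c}{N}{}^i_j=\dot\partial_jG^i$, $\overset{c}{\delta}_k=\frac{\partial}{\partial z^k}-\overset{c}{N}{}^j_k\dot\partial_j$,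 and let $$\overset{B}{L}{}^i_{jk}=\dot\partial_k\overset{c}{N}{}^i_j,\qquad \overset{c}{L}{}^i_{jk}=\tfrac12g^{\bar l i}\bigl(\overset{c}{\delta}_kg_{j\bar l}+\overset{c}{\delta}_jg_{k\bar l}\bigr)$$ be the horizontal coefficients of the connections of Berwald and Rund type. The space is called (complex) Landsberg if $\overset{B}{L}{}^i_{jk}=\overset{c}{L}{}^i_{jk}$ for all $i,j,k$, in all local holomorphic charts and at all $(z,\eta)$ with $\eta\neq0$. In each local chart the local complex Berwald frame is given, with $g=\det(g_{i\bar j})$, by $$l^i=\frac{\eta^i}{F},\quad l_i=g_{i\bar j}\overline{l^j},\quad m^1=\frac{-l_2}{\sqrt g},\quad m^2=\frac{l_1}{\sqrt g},\quad m_i=g_{i\bar j}\overline{m^j}.$$ Put $$A=m^jm^kl_hC^h_{kj},\quad B=m_hm^km^jC^h_{jk},\quad J=l^jl^kl_iL^i_{jk},\quad Y=m^jl^km_iL^i_{jk},\quad E=l^jm^km_iL^i_{jk},$$ and write $f_{|0}:=\eta^k\delta_kf$ for a function $f$ of $(z,\eta)$. Theorem 4.6. The two-dimensional complex Finsler space $(M,F)$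 is Landsberg if and only if, in every local holomorphic chart and at every $(z,\eta)$ with $\eta\ne0$, $$FA(E-Y)=A_{|0}-FA(J+Y)\quad\text{and}\quad FB(E-Y)=B_{|0}-\frac{FB}{2}(J+Y).$$ -/

import Mathlib

open scoped Manifold ContDiff ComplexOrder

noncomputable section

namespace ComplexFinsler

/-! ## Local calculus on `ℂⁿ × ℂⁿ`, with coordinates `(z, η)` -/

/-- Complex coordinate space `ℂⁿ`, the model space of an `n`-dimensional complex manifold. -/
abbrev Coord (n : ℕ) : Type := Fin n → ℂ

/-- The Wirtinger derivative `(∂_v - i ∂_{iv}) / 2` of `f` at `u`, in the real sense. -/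
def wirtinger {V : Type*} [NormedAddCommGroup V] [NormedSpace ℂ V]
    (f : V → ℂ) (u v : V) : ℂ :=
  (1 / 2 : ℂ) * (fderiv ℝ f u v - Complex.I * fderiv ℝ f u (Complex.I • v))

/-- The conjugate Wirtinger derivative `(∂_v + i ∂_{iv}) / 2` of `f` at `u`. -/
def wirtingerBar {V : Type*} [NormedAddCommGroup V] [NormedSpace ℂ V]
    (f : V → ℂ) (u v : V) : ℂ :=
  (1 / 2 : ℂ) * (fderiv ℝ f u v + Complex.I * fderiv ℝ f u (Complex.I • v))

variable {n : ℕ}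

/-- `∂f/∂zᵏ`. -/
def dz (k : Fin n) (f : Coord n × Coord n → ℂ) (u : Coord n × Coord n) : ℂ :=
  wirtinger f u (Pi.single k 1, 0)

/-- `∂f/∂ηᵏ`. -/
def dEta (k : Fin n) (f : Coord n × Coord n → ℂ) (u : Coord n × Coord n) : ℂ :=
  wirtinger f u (0, Pi.single k 1)

/-- `∂f/∂η̄ᵏ`. -/
def dEtaBar (k : Fin n) (f : Coord n × Coord n → ℂ) (u : Coord n × Coord n) : ℂ :=
  wirtingerBar f u (0, Pi.single k 1)

/-! ## Local geometry of a metric function `Φ(z, η)`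

Below `Φ` is the expression of the metric function `F` in a chart.  In every coefficient the
upper index comes first and the lower ones follow in their order. -/

/-- The fundamental metric tensor `g_{i j̄} = ∂²L/∂ηⁱ∂η̄ʲ`, where `L = Φ²`. -/
def metricTensor (Φ : Coord n × Coord n → ℝ) (i j : Fin n) (u : Coord n × Coord n) : ℂ :=
  dEta i (dEtaBar j (fun w => ((Φ w ^ 2 : ℝ) : ℂ))) u

/-- The matrix `(g_{i j̄})`. -/
def metricMatrix (Φ : Coord n × Coord n → ℝ) (u : Coord n × Coord n) :
    Matrix (Fin n) (Fin n) ℂ :=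
  Matrix.of fun i j => metricTensor Φ i j u

/-- `g^{m̄ i}`, the inverse of the metric tensor: `∑ₘ g_{j m̄} g^{m̄ i} = δⱼⁱ`. -/
def metricInv (Φ : Coord n × Coord n → ℝ) (m i : Fin n) (u : Coord n × Coord n) : ℂ :=
  (metricMatrix Φ u)⁻¹ m i

/-- `N_jᵏ = g^{m̄ k} (∂g_{l m̄}/∂zʲ) ηˡ`, the Chern-Finsler nonlinear connection. -/
def cfN (Φ : Coord n × Coord n → ℝ) (k j : Fin n) (u : Coord n × Coord n) : ℂ :=
  ∑ m, ∑ l, metricInv Φ m k u * dz j (metricTensor Φ l m) u * u.2 l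

/-- `δ_k = ∂/∂zᵏ - N_kʲ ∂/∂ηʲ`, the adapted frame of the Chern-Finsler nonlinear connection. -/
def cfDelta (Φ : Coord n × Coord n → ℝ) (k : Fin n) (f : Coord n × Coord n → ℂ)
    (u : Coord n × Coord n) : ℂ :=
  dz k f u - ∑ j, cfN Φ j k u * dEta j f u

/-- `Lⁱ_{jk} = g^{l̄ i} δ_k g_{j l̄}`, the horizontal Chern-Finsler coefficients. -/
def cfL (Φ : Coord n × Coord n → ℝ) (i j k : Fin n) (u : Coord n × Coord n) : ℂ :=
  ∑ l, metricInv Φ l i u * cfDelta Φ k (metricTensor Φ j l) u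

/-- `Cⁱ_{jk} = g^{l̄ i} ∂g_{j l̄}/∂ηᵏ`, the vertical Chern-Finsler coefficients. -/
def cfC (Φ : Coord n × Coord n → ℝ) (i j k : Fin n) (u : Coord n × Coord n) : ℂ :=
  ∑ l, metricInv Φ l i u * dEta k (metricTensor Φ j l) u

/-- `Gⁱ = (1/2) N_jⁱ ηʲ`, the spray coefficients. -/
def sprayG (Φ : Coord n × Coord n → ℝ) (i : Fin n) (u : Coord n × Coord n) : ℂ :=
  (1 / 2 : ℂ) * ∑ j, cfN Φ i j u * u.2 j

/-- `∂Gⁱ/∂ηʲ`, the canonical nonlinear connection. -/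
def canN (Φ : Coord n × Coord n → ℝ) (i j : Fin n) (u : Coord n × Coord n) : ℂ :=
  dEta j (sprayG Φ i) u

/-- The adapted frame of the canonical nonlinear connection. -/
def canDelta (Φ : Coord n × Coord n → ℝ) (k : Fin n) (f : Coord n × Coord n → ℂ)
    (u : Coord n × Coord n) : ℂ :=
  dz k f u - ∑ j, canN Φ j k u * dEta j f u

/-- The horizontal coefficients (lower indices `j k`) of the Berwald type connection: the
derivative by `ηᵏ` of the canonical nonlinear connection. -/
def berwaldL (Φ : Coord n × Coord n → ℝ) (i j k : Fin n) (u : Coord n × Coord n) : ℂ :=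
  dEta k (canN Φ i j) u

/-- The horizontal coefficients (lower indices `j k`) of the Rund type connection. -/
def rundL (Φ : Coord n × Coord n → ℝ) (i j k : Fin n) (u : Coord n × Coord n) : ℂ :=
  (1 / 2 : ℂ) * ∑ l, metricInv Φ l i u *
    (canDelta Φ k (metricTensor Φ j l) u + canDelta Φ j (metricTensor Φ k l) u)

/-! ## The local Berwald frame in dimension two

The indices `1, 2` of the text-book notation are `0, 1 : Fin 2`. -/

/-- `lⁱ = ηⁱ / F`. -/
def lUp (Φ : Coord 2 × Coord 2 → ℝ) (i : Fin 2) (u : Coord 2 × Coord 2) : ℂ :=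
  u.2 i / (Φ u : ℂ)

/-- `l_i = g_{i j̄} l^{j̄}`. -/
def lDown (Φ : Coord 2 × Coord 2 → ℝ) (i : Fin 2) (u : Coord 2 × Coord 2) : ℂ :=
  ∑ j, metricTensor Φ i j u * (starRingEnd ℂ) (lUp Φ j u)

/-- `√g`, where `g = det (g_{i j̄})` (a positive real number for a Hermitian positive definite
matrix). -/
def sqrtDet (Φ : Coord 2 × Coord 2 → ℝ) (u : Coord 2 × Coord 2) : ℝ :=
  Real.sqrt (metricMatrix Φ u).det.re

/-- `m¹ = -l₂ / √g`, `m² = l₁ / √g`. -/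
def mUp (Φ : Coord 2 × Coord 2 → ℝ) (i : Fin 2) (u : Coord 2 × Coord 2) : ℂ :=
  (![-lDown Φ 1 u, lDown Φ 0 u] i) / (sqrtDet Φ u : ℂ)

/-- `m_i = g_{i j̄} m^{j̄}`. -/
def mDown (Φ : Coord 2 × Coord 2 → ℝ) (i : Fin 2) (u : Coord 2 × Coord 2) : ℂ :=
  ∑ j, metricTensor Φ i j u * (starRingEnd ℂ) (mUp Φ j u)

/-- `A = mʲ mᵏ l_h C^h_{kj}`. -/
def coeffA (Φ : Coord 2 × Coord 2 → ℝ) (u : Coord 2 × Coord 2) : ℂ :=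
  ∑ j, ∑ k, ∑ h, mUp Φ j u * mUp Φ k u * lDown Φ h u * cfC Φ h k j u

/-- `B = m_h mᵏ mʲ C^h_{jk}`. -/
def coeffB (Φ : Coord 2 × Coord 2 → ℝ) (u : Coord 2 × Coord 2) : ℂ :=
  ∑ j, ∑ k, ∑ h, mDown Φ h u * mUp Φ k u * mUp Φ j u * cfC Φ h j k u

/-- `J = lʲ lᵏ l_i Lⁱ_{jk}`. -/
def coeffJ (Φ : Coord 2 × Coord 2 → ℝ) (u : Coord 2 × Coord 2) : ℂ :=
  ∑ j, ∑ k, ∑ i, lUp Φ j u * lUp Φ k u * lDown Φ i u * cfL Φ i j k u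

/-- `Y = mʲ lᵏ m_i Lⁱ_{jk}`. -/
def coeffY (Φ : Coord 2 × Coord 2 → ℝ) (u : Coord 2 × Coord 2) : ℂ :=
  ∑ j, ∑ k, ∑ i, mUp Φ j u * lUp Φ k u * mDown Φ i u * cfL Φ i j k u

/-- `E = lʲ mᵏ m_i Lⁱ_{jk}`. -/
def coeffE (Φ : Coord 2 × Coord 2 → ℝ) (u : Coord 2 × Coord 2) : ℂ :=
  ∑ j, ∑ k, ∑ i, lUp Φ j u * mUp Φ k u * mDown Φ i u * cfL Φ i j k u

/-- `f_{|0} = f_{|k} ηᵏ = ηᵏ δ_k f`, the horizontal covariant derivative of a function `f` with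
respect to the Chern-Finsler connection, contracted by `η`. -/
def hcov0 (Φ : Coord n × Coord n → ℝ) (f : Coord n × Coord n → ℂ)
    (u : Coord n × Coord n) : ℂ :=
  ∑ k, u.2 k * cfDelta Φ k f u

/-! ## Complex Finsler spaces -/

section Manifold

variable {M : Type*} [TopologicalSpace M] [ChartedSpace (Coord n) M]
  [IsManifold 𝓘(ℂ, Coord n) ω M]

/-- The expression `(z, η) ↦ F(z, η)` in the holomorphic chart `e` of a function on the
holomorphic tangent bundle `T'M`.  The vector with components `η` at the point with coordinates
`z` is `ηᵏ ∂/∂zᵏ`, the image of `η` under the differential of `e⁻¹`. -/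
def localExpr (F : TangentBundle 𝓘(ℂ, Coord n) M → ℝ)
    (e : OpenPartialHomeomorph M (Coord n)) (u : Coord n × Coord n) : ℝ :=
  F ⟨e.symm u.1, mfderiv 𝓘(ℂ, Coord n) 𝓘(ℂ, Coord n) e.symm u.1 u.2⟩

/-- The part of `T'M` without the zero section that lies over the chart `e`, in coordinates. -/
def slitDomain (e : OpenPartialHomeomorph M (Coord n)) : Set (Coord n × Coord n) :=
  {u | u.1 ∈ e.target ∧ u.2 ≠ 0}

/-- `(M, F)` is a complex Finsler space.  The charts are all holomorphic charts of `M`, and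
smoothness is meant in the real sense. -/
structure IsComplexFinsler (F : TangentBundle 𝓘(ℂ, Coord n) M → ℝ) : Prop where
  continuous : Continuous F
  smooth : ∀ e ∈ IsManifold.maximalAtlas 𝓘(ℂ, Coord n) ω M,
    ContDiffOn ℝ ∞ (fun u => localExpr F e u ^ 2) (slitDomain e)
  nonneg : ∀ v, 0 ≤ F v
  eq_zero_iff : ∀ (p : M) (v : TangentSpace 𝓘(ℂ, Coord n) p), F ⟨p, v⟩ = 0 ↔ v = 0
  homogeneous : ∀ (p : M) (v : TangentSpace 𝓘(ℂ, Coord n) p) (c : ℂ),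
    F ⟨p, c • v⟩ = ‖c‖ * F ⟨p, v⟩
  posDef : ∀ e ∈ IsManifold.maximalAtlas 𝓘(ℂ, Coord n) ω M, ∀ u ∈ slitDomain e,
    (metricMatrix (localExpr F e) u).PosDef

/-- `(M, F)` is a complex Landsberg space: the horizontal coefficients (lower indices `j k`) of
the connections of Berwald type and of Rund type coincide, in all holomorphic charts and at all
nonzero tangent vectors. -/
def IsLandsberg (F : TangentBundle 𝓘(ℂ, Coord n) M → ℝ) : Prop :=
  ∀ e ∈ IsManifold.maximalAtlas 𝓘(ℂ, Coord n) ω M, ∀ u ∈ slitDomain e,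
    ∀ i j k : Fin n, berwaldL (localExpr F e) i j k u = rundL (localExpr F e) i j k u

end Manifold

end ComplexFinsler

end

open ComplexFinsler

/-! The claim is pointwise in each chart. Write Γ for `radialL`, that is Γⁱ_j = Lⁱ_{jk} ηᵏ, and D
for `diffN`, the Chern-Finsler minus the canonical nonlinear connection. Since ∂N_jᵏ/∂η^q = Lᵏ_{qj}
(`dEta_cfN`), the Berwald and Rund coefficients share the symmetrized part of L. The Berwald
remainder is ηˡ ∂Lⁱ_{jl}/∂ηᵏ, which equals Cⁱ_{jk|0} (`sum_eta_dEta_cfL`); the Rund remainder is the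
symmetrized contraction of D with C. So Landsberg means that these two tensors agree.

Both tensors are symmetric in j, k and vanish when contracted with η. In dimension two such a form
is a multiple of m_j m_k (`eq_zero_of_mUp_mUp`), so it suffices to compare values on (m, m) and read
off the components along l and m. The D-side gives F(E - Y)(A l + B m) (`diffN_cfC_mUp_mUp`). The
other side comes from differentiating C(m, m) = A l + B m (`covC_mUp_mUp`): l is parallel along η,
while m drifts by ½ tr Γ, with tr Γ = F(J + Y). The two lower slots cost A and B one full trace
each; the B-component regains half of it from the drift of m in the value. This is the origin of the
factor 1/2 in the second equation. -/

namespace ComplexFinsler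

/-! ### Calculus of local derivations -/

/-- An operator on functions that acts on the smooth functions on `V` as a derivation. -/
structure LocalDerivation {X : Type*} [NormedAddCommGroup X] [NormedSpace ℝ X]
    (V : Set X) (δ : (X → ℂ) → X → ℂ) : Prop where
  smooth : ∀ {f : X → ℂ}, ContDiffOn ℝ ∞ f V → ContDiffOn ℝ ∞ (δ f) V
  -- Locality: an identity that holds only on `V` may be differentiated at the points of `V`. Most
  -- computations below differentiate such an identity.
  congr : ∀ {f h : X → ℂ}, Set.EqOn f h V → Set.EqOn (δ f) (δ h) V
  add : ∀ {f h : X → ℂ}, ContDiffOn ℝ ∞ f V → ContDiffOn ℝ ∞ h V →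
    ∀ u ∈ V, δ (fun w => f w + h w) u = δ f u + δ h u
  mul : ∀ {f h : X → ℂ}, ContDiffOn ℝ ∞ f V → ContDiffOn ℝ ∞ h V →
    ∀ u ∈ V, δ (fun w => f w * h w) u = δ f u * h u + f u * δ h u
  const : ∀ (c : ℂ), ∀ u ∈ V, δ (fun _ => c) u = 0

namespace LocalDerivation

variable {X : Type*} [NormedAddCommGroup X] [NormedSpace ℝ X] {V : Set X}
  {δ : (X → ℂ) → X → ℂ}

theorem const_mul (hδ : LocalDerivation V δ) {f : X → ℂ} (hf : ContDiffOn ℝ ∞ f V) (c : ℂ)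
    {u : X} (hu : u ∈ V) : δ (fun w => c * f w) u = c * δ f u := by
  rw [hδ.mul contDiffOn_const hf u hu, hδ.const c u hu]; ring

theorem neg (hδ : LocalDerivation V δ) {f : X → ℂ} (hf : ContDiffOn ℝ ∞ f V)
    {u : X} (hu : u ∈ V) : δ (fun w => -f w) u = -δ f u := by
  have := hδ.const_mul hf (-1) hu
  simpa using this

theorem sub (hδ : LocalDerivation V δ) {f h : X → ℂ} (hf : ContDiffOn ℝ ∞ f V)
    (hh : ContDiffOn ℝ ∞ h V) {u : X} (hu : u ∈ V) :
    δ (fun w => f w - h w) u = δ f u - δ h u := by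
  simp only [sub_eq_add_neg]
  rw [hδ.add hf hh.neg u hu, hδ.neg hh hu]

theorem sum (hδ : LocalDerivation V δ) {ι : Type*} (s : Finset ι) {f : ι → X → ℂ}
    (hf : ∀ i, ContDiffOn ℝ ∞ (f i) V) {u : X} (hu : u ∈ V) :
    δ (fun w => ∑ i ∈ s, f i w) u = ∑ i ∈ s, δ (f i) u := by
  classical
  induction s using Finset.induction_on with
  | empty => simpa using hδ.const 0 u hu
  | insert a s ha ih =>
    simp only [Finset.sum_insert ha]
    rw [hδ.add (hf a) (ContDiffOn.sum fun i _ => hf i) u hu, ih]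

theorem sum_mul (hδ : LocalDerivation V δ) {ι : Type*} [Fintype ι] {f h : ι → X → ℂ}
    (hf : ∀ i, ContDiffOn ℝ ∞ (f i) V) (hh : ∀ i, ContDiffOn ℝ ∞ (h i) V) {u : X} (hu : u ∈ V) :
    δ (fun w => ∑ i, f i w * h i w) u = ∑ i, (δ (f i) u * h i u + f i u * δ (h i) u) := by
  rw [hδ.sum _ (fun i => (hf i).mul (hh i)) hu]
  exact Finset.sum_congr rfl fun i _ => hδ.mul (hf i) (hh i) u hu

/-- Sums of multiples of local derivations by smooth functions are local derivations. -/
theorem linearCombination {ι : Type*} [Fintype ι] {d : ι → (X → ℂ) → X → ℂ} {a : ι → X → ℂ}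
    (hd : ∀ i, LocalDerivation V (d i)) (ha : ∀ i, ContDiffOn ℝ ∞ (a i) V) :
    LocalDerivation V (fun f u => ∑ i, a i u * d i f u) where
  smooth hf := ContDiffOn.sum fun i _ => (ha i).mul ((hd i).smooth hf)
  congr h u hu := Finset.sum_congr rfl fun i _ => by rw [(hd i).congr h hu]
  add hf hh u hu := by
    rw [← Finset.sum_add_distrib]
    exact Finset.sum_congr rfl fun i _ => by rw [(hd i).add hf hh u hu]; ring
  mul hf hh u hu := by
    rw [Finset.sum_mul, Finset.mul_sum, ← Finset.sum_add_distrib]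
    exact Finset.sum_congr rfl fun i _ => by rw [(hd i).mul hf hh u hu]; ring
  const c u hu := Finset.sum_eq_zero fun i _ => by rw [(hd i).const c u hu, mul_zero]

theorem difference {d d' : (X → ℂ) → X → ℂ} (hd : LocalDerivation V d)
    (hd' : LocalDerivation V d') : LocalDerivation V (fun f u => d f u - d' f u) where
  smooth hf := (hd.smooth hf).sub (hd'.smooth hf)
  congr h u hu := by simp only [hd.congr h hu, hd'.congr h hu]
  add hf hh u hu := by rw [hd.add hf hh u hu, hd'.add hf hh u hu]; ring
  mul hf hh u hu := by rw [hd.mul hf hh u hu, hd'.mul hf hh u hu]; ring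
  const c u hu := by rw [hd.const c u hu, hd'.const c u hu, sub_zero]

end LocalDerivation

/-! ### Wirtinger derivatives in a fixed direction and their commutation -/

section Wirtinger

variable {X : Type*} [NormedAddCommGroup X] [NormedSpace ℂ X] {V : Set X}

/-- The derivative `(∂_v + c ∂_{iv}) / 2`, which covers both Wirtinger derivatives. -/
noncomputable def wirtingerWith (c : ℂ) (v : X) (f : X → ℂ) (u : X) : ℂ :=
  (1 / 2 : ℂ) * (fderiv ℝ f u v + c * fderiv ℝ f u (Complex.I • v))

theorem wirtinger_eq (f : X → ℂ) (u v : X) :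
    wirtinger f u v = wirtingerWith (-Complex.I) v f u := by
  simp only [wirtinger, wirtingerWith]; ring

theorem differentiableAt_of_contDiffOn (hV : IsOpen V) {f : X → ℂ} (hf : ContDiffOn ℝ ∞ f V)
    {u : X} (hu : u ∈ V) : DifferentiableAt ℝ f u :=
  (hf.contDiffAt (hV.mem_nhds hu)).differentiableAt (by simp)

theorem contDiffOn_fderiv_apply (hV : IsOpen V) {f : X → ℂ} (hf : ContDiffOn ℝ ∞ f V) (v : X) :
    ContDiffOn ℝ ∞ (fun u => fderiv ℝ f u v) V :=
  (hf.fderiv_of_isOpen hV (by simp)).clm_apply contDiffOn_const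

theorem localDerivation_wirtingerWith (hV : IsOpen V) (c : ℂ) (v : X) :
    LocalDerivation V (wirtingerWith c v) where
  smooth hf := contDiffOn_const.mul ((contDiffOn_fderiv_apply hV hf _).add
    (contDiffOn_const.mul (contDiffOn_fderiv_apply hV hf _)))
  congr h u hu := by
    simp only [wirtingerWith, (h.eventuallyEq_of_mem (hV.mem_nhds hu)).fderiv_eq]
  add hf hh u hu := by
    simp only [wirtingerWith]
    rw [fderiv_fun_add (differentiableAt_of_contDiffOn hV hf hu)
      (differentiableAt_of_contDiffOn hV hh hu)]
    simp only [add_apply]; ring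
  mul hf hh u hu := by
    simp only [wirtingerWith]
    rw [fderiv_fun_mul (differentiableAt_of_contDiffOn hV hf hu)
      (differentiableAt_of_contDiffOn hV hh hu)]
    simp only [add_apply, smul_apply, smul_eq_mul]; ring
  const c u hu := by simp [wirtingerWith]

theorem fderiv_wirtingerWith (hV : IsOpen V) {f : X → ℂ} (hf : ContDiffOn ℝ ∞ f V)
    {u : X} (hu : u ∈ V) (c : ℂ) (v w : X) :
    fderiv ℝ (wirtingerWith c v f) u w =
      (1 / 2 : ℂ) * (fderiv ℝ (fderiv ℝ f) u w v
        + c * fderiv ℝ (fderiv ℝ f) u w (Complex.I • v)) := by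
  have hd : DifferentiableAt ℝ (fderiv ℝ f) u :=
    ((hf.fderiv_of_isOpen (m := ∞) hV (by simp)).contDiffAt (hV.mem_nhds hu)).differentiableAt
      (by simp)
  have h1 : ∀ a : X, HasFDerivAt (fun x => fderiv ℝ f x a) ((fderiv ℝ (fderiv ℝ f) u).flip a) u := by
    intro a
    simpa using hd.hasFDerivAt.clm_apply (hasFDerivAt_const a u)
  have h2 : HasFDerivAt (wirtingerWith c v f) _ u :=
    ((h1 v).add ((h1 (Complex.I • v)).const_mul c)).const_mul (1 / 2 : ℂ)
  rw [h2.fderiv]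
  simp only [smul_apply, add_apply, ContinuousLinearMap.flip_apply, smul_eq_mul]

/-- Both operators have constant coefficients, so this reduces to the symmetry of the real second
derivative in the four pairs of directions. -/
theorem wirtingerWith_comm (hV : IsOpen V) {f : X → ℂ} (hf : ContDiffOn ℝ ∞ f V)
    {u : X} (hu : u ∈ V) (c d : ℂ) (v w : X) :
    wirtingerWith c v (wirtingerWith d w f) u = wirtingerWith d w (wirtingerWith c v f) u := by
  have hs : IsSymmSndFDerivAt ℝ f u :=
    (hf.contDiffAt (hV.mem_nhds hu)).isSymmSndFDerivAt
      (by simpa using WithTop.coe_le_coe.2 (le_top : (2 : ℕ∞) ≤ ⊤))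
  rw [wirtingerWith, wirtingerWith, fderiv_wirtingerWith hV hf hu, fderiv_wirtingerWith hV hf hu,
    fderiv_wirtingerWith hV hf hu, fderiv_wirtingerWith hV hf hu, hs.eq v w,
    hs.eq v (Complex.I • w), hs.eq (Complex.I • v) w, hs.eq (Complex.I • v) (Complex.I • w)]
  ring

/-- A Wirtinger derivative in terms of the differential, where the latter is known. -/
theorem wirtingerWith_of_hasFDerivAt {f : X → ℂ} {f' : X →L[ℝ] ℂ} {u : X}
    (h : HasFDerivAt f f' u) (c : ℂ) (v : X) :
    wirtingerWith c v f u = (1 / 2 : ℂ) * (f' v + c * f' (Complex.I • v)) := by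
  rw [wirtingerWith, h.fderiv]

end Wirtinger

end ComplexFinsler

namespace ComplexFinsler

variable {n : ℕ}

/-! ### Coordinate derivatives of functions and of the fibre coordinates -/

section Coordinates

theorem dz_eq (k : Fin n) :
    dz k = wirtingerWith (-Complex.I) ((Pi.single k 1, 0) : Coord n × Coord n) := by
  funext f u; exact wirtinger_eq _ _ _

theorem dEta_eq (k : Fin n) :
    dEta k = wirtingerWith (-Complex.I) ((0, Pi.single k 1) : Coord n × Coord n) := by
  funext f u; exact wirtinger_eq _ _ _

theorem dEtaBar_eq (k : Fin n) :
    dEtaBar k = wirtingerWith Complex.I ((0, Pi.single k 1) : Coord n × Coord n) := rfl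

variable {V : Set (Coord n × Coord n)}

theorem localDerivation_dz (hV : IsOpen V) (k : Fin n) : LocalDerivation V (dz k) := by
  rw [dz_eq]; exact localDerivation_wirtingerWith hV _ _

theorem localDerivation_dEta (hV : IsOpen V) (k : Fin n) : LocalDerivation V (dEta k) := by
  rw [dEta_eq]; exact localDerivation_wirtingerWith hV _ _

theorem localDerivation_dEtaBar (hV : IsOpen V) (k : Fin n) :
    LocalDerivation V (dEtaBar k) := by
  rw [dEtaBar_eq]; exact localDerivation_wirtingerWith hV _ _

section Commute

variable {f : Coord n × Coord n → ℂ} {u : Coord n × Coord n}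

theorem dEta_dEta_comm (hV : IsOpen V) (hf : ContDiffOn ℝ ∞ f V) (hu : u ∈ V) (j k : Fin n) :
    dEta j (dEta k f) u = dEta k (dEta j f) u := by
  rw [dEta_eq, dEta_eq]; exact wirtingerWith_comm hV hf hu _ _ _ _

theorem dEta_dEtaBar_comm (hV : IsOpen V) (hf : ContDiffOn ℝ ∞ f V) (hu : u ∈ V) (j k : Fin n) :
    dEta j (dEtaBar k f) u = dEtaBar k (dEta j f) u := by
  rw [dEta_eq, dEtaBar_eq]; exact wirtingerWith_comm hV hf hu _ _ _ _

theorem dEta_dz_comm (hV : IsOpen V) (hf : ContDiffOn ℝ ∞ f V) (hu : u ∈ V) (j k : Fin n) :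
    dEta j (dz k f) u = dz k (dEta j f) u := by
  rw [dEta_eq, dz_eq]; exact wirtingerWith_comm hV hf hu _ _ _ _

end Commute

/-- The coordinate `ηⁱ` as a continuous real-linear functional. -/
noncomputable def etaCLM (i : Fin n) : (Coord n × Coord n) →L[ℝ] ℂ :=
  (ContinuousLinearMap.proj (R := ℝ) (φ := fun _ : Fin n => ℂ) i).comp
    (ContinuousLinearMap.snd ℝ (Coord n) (Coord n))

theorem hasFDerivAt_eta (i : Fin n) (u : Coord n × Coord n) :
    HasFDerivAt (fun w : Coord n × Coord n => w.2 i) (etaCLM i) u :=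
  (etaCLM i).hasFDerivAt

theorem hasFDerivAt_etaConj (i : Fin n) (u : Coord n × Coord n) :
    HasFDerivAt (fun w : Coord n × Coord n => (starRingEnd ℂ) (w.2 i))
      ((Complex.conjCLE : ℂ →L[ℝ] ℂ).comp (etaCLM i)) u :=
  ((Complex.conjCLE : ℂ →L[ℝ] ℂ).comp (etaCLM i)).hasFDerivAt

theorem contDiffOn_eta (i : Fin n) :
    ContDiffOn ℝ ∞ (fun w : Coord n × Coord n => w.2 i) V :=
  (etaCLM i).contDiff.contDiffOn

theorem contDiffOn_etaConj (i : Fin n) :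
    ContDiffOn ℝ ∞ (fun w : Coord n × Coord n => (starRingEnd ℂ) (w.2 i)) V :=
  ((Complex.conjCLE : ℂ →L[ℝ] ℂ).comp (etaCLM i)).contDiff.contDiffOn

theorem dz_eta (k i : Fin n) (u : Coord n × Coord n) : dz k (fun w => w.2 i) u = 0 := by
  rw [dz_eq, wirtingerWith_of_hasFDerivAt (hasFDerivAt_eta i u)]
  simp [etaCLM]

theorem dEta_eta (k i : Fin n) (u : Coord n × Coord n) :
    dEta k (fun w => w.2 i) u = if i = k then 1 else 0 := by
  rw [dEta_eq, wirtingerWith_of_hasFDerivAt (hasFDerivAt_eta i u)]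
  by_cases h : i = k
  · subst h; simp [etaCLM]; norm_num
  · simp [etaCLM, h]

theorem dEtaBar_eta (k i : Fin n) (u : Coord n × Coord n) :
    dEtaBar k (fun w => w.2 i) u = 0 := by
  rw [dEtaBar_eq, wirtingerWith_of_hasFDerivAt (hasFDerivAt_eta i u)]
  by_cases h : i = k
  · subst h; simp [etaCLM]
  · simp [etaCLM, Pi.single_eq_of_ne h]

theorem dz_etaConj (k i : Fin n) (u : Coord n × Coord n) :
    dz k (fun w => (starRingEnd ℂ) (w.2 i)) u = 0 := by
  rw [dz_eq, wirtingerWith_of_hasFDerivAt (hasFDerivAt_etaConj i u)]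
  simp [etaCLM]

theorem dEta_etaConj (k i : Fin n) (u : Coord n × Coord n) :
    dEta k (fun w => (starRingEnd ℂ) (w.2 i)) u = 0 := by
  rw [dEta_eq, wirtingerWith_of_hasFDerivAt (hasFDerivAt_etaConj i u)]
  by_cases h : i = k
  · subst h; simp [etaCLM]
  · simp [etaCLM, Pi.single_eq_of_ne h]

end Coordinates

/-! ### Radial derivatives in the fibre -/

section Euler

variable {X : Type*} [NormedAddCommGroup X] [NormedSpace ℂ X]

/-- The factor is `a` for `c = -i` and the conjugate of `a` for `c = i`: complex linearity and
antilinearity in the direction at once. -/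
theorem wirtingerWith_smul {c : ℂ} (hc : c * c = -1) (f : X → ℂ) (u v : X) (a : ℂ) :
    wirtingerWith c (a • v) f u = (a.re - c * a.im) * wirtingerWith c v f u := by
  have h1 : a • v = a.re • v + a.im • (Complex.I • v) := by
    conv_lhs => rw [← Complex.re_add_im a]
    rw [add_smul, mul_smul, Complex.coe_smul, Complex.coe_smul]
  have h2 : Complex.I • a • v = a.re • (Complex.I • v) - a.im • v := by
    rw [h1, smul_add, smul_comm Complex.I a.re, smul_comm Complex.I a.im, smul_smul Complex.I,
      Complex.I_mul_I, neg_one_smul, smul_neg, sub_eq_add_neg]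
  simp only [wirtingerWith]
  rw [h2, h1, map_add, map_sub]
  simp only [map_smul, Complex.real_smul]
  linear_combination (a.im / 2 * fderiv ℝ f u (Complex.I • v)) * hc

theorem wirtingerWith_sum (c : ℂ) {ι : Type*} (s : Finset ι) (v : ι → X) (f : X → ℂ) (u : X) :
    wirtingerWith c (∑ i ∈ s, v i) f u = ∑ i ∈ s, wirtingerWith c (v i) f u := by
  simp only [wirtingerWith, map_sum, Finset.smul_sum, Finset.mul_sum, ← Finset.sum_add_distrib]

theorem sum_eta_dEta (f : Coord n × Coord n → ℂ) (u : Coord n × Coord n) :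
    ∑ i, u.2 i * dEta i f u = wirtingerWith (-Complex.I) (0, u.2) f u := by
  have h : ((0, u.2) : Coord n × Coord n)
      = ∑ i, u.2 i • ((0, Pi.single i 1) : Coord n × Coord n) := by
    ext j
    · simp [Prod.fst_sum]
    · simp [Prod.snd_sum, Finset.sum_apply, Pi.single_apply]
  rw [h, wirtingerWith_sum]
  refine Finset.sum_congr rfl fun i _ => ?_
  rw [wirtingerWith_smul (by simp), dEta_eq]
  congr 1
  conv_lhs => rw [← Complex.re_add_im (u.2 i)]
  ring

theorem sum_etaConj_dEtaBar (f : Coord n × Coord n → ℂ) (u : Coord n × Coord n) :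
    ∑ i, (starRingEnd ℂ) (u.2 i) * dEtaBar i f u = wirtingerWith Complex.I (0, u.2) f u := by
  have h : ((0, u.2) : Coord n × Coord n)
      = ∑ i, u.2 i • ((0, Pi.single i 1) : Coord n × Coord n) := by
    ext j
    · simp [Prod.fst_sum]
    · simp [Prod.snd_sum, Finset.sum_apply, Pi.single_apply]
  rw [h, wirtingerWith_sum]
  refine Finset.sum_congr rfl fun i _ => ?_
  rw [wirtingerWith_smul (by simp), dEtaBar_eq]
  congr 1
  apply Complex.ext <;> simp

end Euler

/-! ### Local Finsler metrics: Euler identities, positivity, smoothness -/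

/-- A function with the properties of the local expression of a complex Finsler metric on an open
set of nonzero tangent vectors. -/
structure IsLocalFinsler (Φ : Coord n × Coord n → ℝ) (V : Set (Coord n × Coord n)) : Prop where
  isOpen : IsOpen V
  smooth : ContDiffOn ℝ ∞ (fun u => Φ u ^ 2) V
  nonneg : ∀ u, 0 ≤ Φ u
  homogeneous : ∀ (z η : Coord n) (c : ℂ), Φ (z, c • η) = ‖c‖ * Φ (z, η)
  ne_zero : ∀ u ∈ V, u.2 ≠ 0
  posDef : ∀ u ∈ V, (metricMatrix Φ u).PosDef

/-- The energy `L = Φ²` as a complex-valued function. -/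
noncomputable def energy (Φ : Coord n × Coord n → ℝ) (u : Coord n × Coord n) : ℂ :=
  ((Φ u ^ 2 : ℝ) : ℂ)

namespace IsLocalFinsler

variable {Φ : Coord n × Coord n → ℝ} {V : Set (Coord n × Coord n)} {u : Coord n × Coord n}

theorem contDiffOn_energy (h : IsLocalFinsler Φ V) : ContDiffOn ℝ ∞ (energy Φ) V :=
  Complex.ofRealCLM.contDiff.comp_contDiffOn h.smooth

theorem contDiffOn_dEtaBar_energy (h : IsLocalFinsler Φ V) (m : Fin n) :
    ContDiffOn ℝ ∞ (dEtaBar m (energy Φ)) V :=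
  (localDerivation_dEtaBar h.isOpen m).smooth h.contDiffOn_energy

theorem contDiffOn_metricTensor (h : IsLocalFinsler Φ V) (i m : Fin n) :
    ContDiffOn ℝ ∞ (metricTensor Φ i m) V :=
  (localDerivation_dEta h.isOpen i).smooth (h.contDiffOn_dEtaBar_energy m)

theorem energy_homogeneous (h : IsLocalFinsler Φ V) (u : Coord n × Coord n) (c : ℂ) :
    energy Φ (u.1, c • u.2) = (‖c‖ : ℂ) ^ 2 * energy Φ u := by
  simp only [energy, h.homogeneous]
  push_cast; ring

/-- On the ray `(1 + t)η` the energy is multiplied by `(1 + t)²`. -/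
theorem fderiv_energy (h : IsLocalFinsler Φ V) (hu : u ∈ V) :
    fderiv ℝ (energy Φ) u (0, u.2) = 2 * energy Φ u := by
  have h1 := (differentiableAt_of_contDiffOn h.isOpen h.contDiffOn_energy
    hu).hasFDerivAt.hasLineDerivAt ((0, u.2) : Coord n × Coord n)
  have h2 : HasDerivAt (fun t : ℝ => ((1 + t : ℝ) : ℂ) ^ 2 * energy Φ u)
      (2 * energy Φ u) 0 := by
    have h3 : HasDerivAt (fun t : ℝ => ((1 + t : ℝ) : ℂ)) 1 0 := by
      simpa using ((hasDerivAt_id (0 : ℝ)).const_add 1).ofReal_comp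
    simpa using (h3.pow 2).mul_const (energy Φ u)
  refine HasDerivAt.unique h1 (h2.congr_of_eventuallyEq (Filter.Eventually.of_forall fun t => ?_))
  have h4 : u + t • ((0, u.2) : Coord n × Coord n) = (u.1, ((1 + t : ℝ) : ℂ) • u.2) := by
    ext j <;> simp; ring
  change energy Φ (u + t • ((0, u.2) : Coord n × Coord n)) = _
  rw [h4, h.energy_homogeneous, Complex.norm_real, Real.norm_eq_abs]
  congr 1
  rw [← Complex.ofReal_pow, sq_abs, Complex.ofReal_pow]

/-- In the direction `iη` the factor is `|1 + it|² = 1 + t²`, which is stationary at 0. -/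
theorem fderiv_energy_I (h : IsLocalFinsler Φ V) (hu : u ∈ V) :
    fderiv ℝ (energy Φ) u (Complex.I • (0, u.2)) = 0 := by
  have h1 := (differentiableAt_of_contDiffOn h.isOpen h.contDiffOn_energy
    hu).hasFDerivAt.hasLineDerivAt (Complex.I • ((0, u.2) : Coord n × Coord n))
  have h2 : HasDerivAt (fun t : ℝ => ((1 + t ^ 2 : ℝ) : ℂ) * energy Φ u) 0 0 := by
    have h3 : HasDerivAt (fun t : ℝ => ((1 + t ^ 2 : ℝ) : ℂ)) 0 0 := by
      simpa using (((hasDerivAt_id (0 : ℝ)).pow 2).const_add 1).ofReal_comp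
    simpa using h3.mul_const (energy Φ u)
  refine HasDerivAt.unique h1 (h2.congr_of_eventuallyEq (Filter.Eventually.of_forall fun t => ?_))
  have h4 : u + t • (Complex.I • ((0, u.2) : Coord n × Coord n))
      = (u.1, (1 + t * Complex.I) • u.2) := by
    ext j <;> simp; ring
  change energy Φ (u + t • (Complex.I • ((0, u.2) : Coord n × Coord n))) = _
  rw [h4, h.energy_homogeneous, ← Complex.ofReal_pow, Complex.sq_norm, Complex.normSq_apply]
  congr 2
  simp [sq]

/-- Euler's identity `ηⁱ ∂L/∂ηⁱ = L`. -/
theorem sum_eta_dEta_energy (h : IsLocalFinsler Φ V) (hu : u ∈ V) :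
    ∑ i, u.2 i * dEta i (energy Φ) u = energy Φ u := by
  rw [sum_eta_dEta, wirtingerWith, h.fderiv_energy hu, h.fderiv_energy_I hu]; ring

/-- Euler's identity `η̄ᵐ ∂L/∂η̄ᵐ = L`. -/
theorem sum_etaConj_dEtaBar_energy (h : IsLocalFinsler Φ V) (hu : u ∈ V) :
    ∑ m, (starRingEnd ℂ) (u.2 m) * dEtaBar m (energy Φ) u = energy Φ u := by
  rw [sum_etaConj_dEtaBar, wirtingerWith, h.fderiv_energy hu, h.fderiv_energy_I hu]; ring

/-- `ηⁱ g_{i m̄} = ∂L/∂η̄ᵐ`. -/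
theorem sum_eta_metricTensor (h : IsLocalFinsler Φ V) (hu : u ∈ V) (m : Fin n) :
    ∑ i, u.2 i * metricTensor Φ i m u = dEtaBar m (energy Φ) u := by
  have hδ := localDerivation_dEtaBar h.isOpen m
  have h1 := hδ.congr (fun w hw => h.sum_eta_dEta_energy hw) hu
  rw [← h1, hδ.sum_mul (fun i => contDiffOn_eta i)
    (fun i => (localDerivation_dEta h.isOpen i).smooth h.contDiffOn_energy) hu]
  refine Finset.sum_congr rfl fun i _ => ?_
  rw [dEtaBar_eta, ← dEta_dEtaBar_comm h.isOpen h.contDiffOn_energy hu]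
  rw [zero_mul, zero_add]; rfl

/-- `g_{i m̄} η̄ᵐ = ∂L/∂ηⁱ`. -/
theorem sum_metricTensor_etaConj (h : IsLocalFinsler Φ V) (hu : u ∈ V) (i : Fin n) :
    ∑ m, (starRingEnd ℂ) (u.2 m) * metricTensor Φ i m u = dEta i (energy Φ) u := by
  have hδ := localDerivation_dEta h.isOpen i
  have h1 := hδ.congr (fun w hw => h.sum_etaConj_dEtaBar_energy hw) hu
  rw [← h1, hδ.sum_mul (fun i => contDiffOn_etaConj i) h.contDiffOn_dEtaBar_energy hu]
  refine Finset.sum_congr rfl fun m _ => ?_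
  rw [dEta_etaConj, zero_mul, zero_add]; rfl

/-- Both sides are the same third derivative of the energy. This is the source of the symmetry of C.
-/
theorem dEta_metricTensor_comm (h : IsLocalFinsler Φ V) (hu : u ∈ V) (i k m : Fin n) :
    dEta k (metricTensor Φ i m) u = dEta i (metricTensor Φ k m) u :=
  dEta_dEta_comm h.isOpen (h.contDiffOn_dEtaBar_energy m) hu k i

theorem dEta_dz_metric (h : IsLocalFinsler Φ V) (hu : u ∈ V) (i j m : Fin n) :
    dEta i (dz j (dEtaBar m (energy Φ))) u = dz j (metricTensor Φ i m) u :=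
  dEta_dz_comm h.isOpen (h.contDiffOn_dEtaBar_energy m) hu i j

/-- `ηⁱ ∂g_{i m̄}/∂ηᵏ = 0`. -/
theorem sum_eta_dEta_metricTensor (h : IsLocalFinsler Φ V) (hu : u ∈ V) (k m : Fin n) :
    ∑ i, u.2 i * dEta k (metricTensor Φ i m) u = 0 := by
  have hδ := localDerivation_dEta h.isOpen k
  have h1 := hδ.congr (fun w hw => h.sum_eta_metricTensor hw m) hu
  rw [hδ.sum_mul (fun i => contDiffOn_eta i) (fun i => h.contDiffOn_metricTensor i m) hu] at h1
  simp only [dEta_eta, Finset.sum_add_distrib, ite_mul, one_mul, zero_mul, Finset.sum_ite_eq',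
    Finset.mem_univ, if_true] at h1
  exact add_eq_left.1 h1

/-- By Euler's identities the energy is the Hermitian form of the metric at η. The holomorphic index
comes first in the matrix, so the vector to insert is the conjugate of η. -/
theorem energy_pos (h : IsLocalFinsler Φ V) (hu : u ∈ V) : 0 < Φ u ^ 2 := by
  have h1 : energy Φ u = star (star u.2) ⬝ᵥ (metricMatrix Φ u).mulVec (star u.2) := by
    rw [← h.sum_eta_dEta_energy hu]
    simp only [dotProduct, Matrix.mulVec, star_star]
    refine Finset.sum_congr rfl fun i _ => ?_
    rw [← h.sum_metricTensor_etaConj hu i]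
    congr 1
    exact Finset.sum_congr rfl fun m _ => mul_comm _ _
  have h2 := (h.posDef u hu).dotProduct_mulVec_pos (x := star u.2)
    (by simpa using h.ne_zero u hu)
  rw [← h1] at h2
  exact Complex.zero_lt_real.1 h2

theorem pos (h : IsLocalFinsler Φ V) (hu : u ∈ V) : 0 < Φ u :=
  (h.nonneg u).lt_of_ne fun h0 => by simpa [← h0] using h.energy_pos hu

theorem contDiffOn_norm (h : IsLocalFinsler Φ V) : ContDiffOn ℝ ∞ (fun w => (Φ w : ℂ)) V := by
  refine Complex.ofRealCLM.contDiff.comp_contDiffOn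
    ((h.smooth.sqrt fun w hw => (h.energy_pos hw).ne').congr fun w _ => ?_)
  exact (Real.sqrt_sq (h.nonneg w)).symm

/-! ### The inverse metric -/

theorem isUnit_det (h : IsLocalFinsler Φ V) (hu : u ∈ V) : IsUnit (metricMatrix Φ u).det :=
  (h.posDef u hu).det_pos.ne'.isUnit

/-- Identities for N and L are proved after lowering their upper index and then cancelling the
metric, so the inverse metric never has to be differentiated. -/
theorem metric_cancel (h : IsLocalFinsler Φ V) (hu : u ∈ V) {x y : Fin n → ℂ}
    (hxy : ∀ m, ∑ i, metricTensor Φ i m u * x i = ∑ i, metricTensor Φ i m u * y i) : x = y := by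
  refine Matrix.vecMul_injective_of_isUnit
    ((Matrix.isUnit_iff_isUnit_det _).2 (h.isUnit_det hu)) ?_
  funext m
  simpa [Matrix.vecMul, dotProduct, metricMatrix, mul_comm] using hxy m

/-- Lowering an index after raising it. -/
theorem metric_lower (h : IsLocalFinsler Φ V) (hu : u ∈ V) (x : Fin n → ℂ) (m : Fin n) :
    ∑ i, metricTensor Φ i m u * (∑ l, metricInv Φ l i u * x l) = x m := by
  have h1 : (metricMatrix Φ u)⁻¹ * metricMatrix Φ u = 1 :=
    Matrix.nonsing_inv_mul _ (h.isUnit_det hu)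
  have h2 : Matrix.vecMul (Matrix.vecMul x (metricMatrix Φ u)⁻¹) (metricMatrix Φ u) = x := by
    rw [Matrix.vecMul_vecMul, h1, Matrix.vecMul_one]
  have h3 := congrFun h2 m
  simp only [Matrix.vecMul, dotProduct] at h3
  conv_rhs => rw [← h3]
  refine Finset.sum_congr rfl fun i _ => ?_
  rw [mul_comm]
  congr 1
  exact Finset.sum_congr rfl fun l _ => mul_comm _ _

theorem contDiffOn_det {X : Type*} [NormedAddCommGroup X] [NormedSpace ℝ X] {W : Set X}
    {A : X → Matrix (Fin n) (Fin n) ℂ} (hA : ∀ i j, ContDiffOn ℝ ∞ (fun w => A w i j) W) :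
    ContDiffOn ℝ ∞ (fun w => (A w).det) W := by
  simp only [Matrix.det_apply']
  exact ContDiffOn.sum fun σ _ => contDiffOn_const.mul (contDiffOn_prod fun i _ => hA _ _)

theorem contDiffOn_metricInv (h : IsLocalFinsler Φ V) (m i : Fin n) :
    ContDiffOn ℝ ∞ (metricInv Φ m i) V := by
  -- Cramer's rule exhibits the entry as a quotient of polynomials in the metric coefficients.
  have h1 : metricInv Φ m i = fun w => (metricMatrix Φ w).det⁻¹ *
      ((metricMatrix Φ w).updateRow i (Pi.single m 1)).det := by
    funext w
    simp [metricInv, Matrix.inv_def, Matrix.adjugate_apply]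
  rw [h1]
  refine ((contDiffOn_det fun i j => h.contDiffOn_metricTensor i j).inv
    fun w hw => (h.isUnit_det hw).ne_zero).mul (contDiffOn_det fun a b => ?_)
  by_cases hai : a = i
  · subst hai; simpa using contDiffOn_const
  · simp only [Matrix.updateRow_ne hai]
    exact h.contDiffOn_metricTensor a b

end IsLocalFinsler

end ComplexFinsler

namespace ComplexFinsler

namespace IsLocalFinsler

variable {n : ℕ} {Φ : Coord n × Coord n → ℝ} {V : Set (Coord n × Coord n)}
  {u : Coord n × Coord n}

/-! ### The Chern-Finsler connection -/

theorem contDiffOn_cfN (h : IsLocalFinsler Φ V) (k j : Fin n) :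
    ContDiffOn ℝ ∞ (cfN Φ k j) V :=
  ContDiffOn.sum fun m _ => ContDiffOn.sum fun l _ => ((h.contDiffOn_metricInv m k).mul
    ((localDerivation_dz h.isOpen j).smooth (h.contDiffOn_metricTensor l m))).mul
    (contDiffOn_eta l)

theorem localDerivation_cfDelta (h : IsLocalFinsler Φ V) (k : Fin n) :
    LocalDerivation V (cfDelta Φ k) :=
  (localDerivation_dz h.isOpen k).difference (LocalDerivation.linearCombination
    (fun j => localDerivation_dEta h.isOpen j) (fun j => h.contDiffOn_cfN j k))

theorem localDerivation_hcov0 (h : IsLocalFinsler Φ V) : LocalDerivation V (hcov0 Φ) :=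
  LocalDerivation.linearCombination (fun k => h.localDerivation_cfDelta k)
    (fun k => contDiffOn_eta k)

theorem contDiffOn_cfL (h : IsLocalFinsler Φ V) (i j k : Fin n) :
    ContDiffOn ℝ ∞ (cfL Φ i j k) V :=
  ContDiffOn.sum fun l _ => (h.contDiffOn_metricInv l i).mul
    ((h.localDerivation_cfDelta k).smooth (h.contDiffOn_metricTensor j l))

theorem contDiffOn_cfC (h : IsLocalFinsler Φ V) (i j k : Fin n) :
    ContDiffOn ℝ ∞ (cfC Φ i j k) V :=
  ContDiffOn.sum fun l _ => (h.contDiffOn_metricInv l i).mul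
    ((localDerivation_dEta h.isOpen k).smooth (h.contDiffOn_metricTensor j l))

theorem metric_cfC (h : IsLocalFinsler Φ V) (hu : u ∈ V) (j k m : Fin n) :
    ∑ i, metricTensor Φ i m u * cfC Φ i j k u = dEta k (metricTensor Φ j m) u :=
  h.metric_lower hu (fun l => dEta k (metricTensor Φ j l) u) m

theorem metric_cfL (h : IsLocalFinsler Φ V) (hu : u ∈ V) (j k m : Fin n) :
    ∑ i, metricTensor Φ i m u * cfL Φ i j k u = cfDelta Φ k (metricTensor Φ j m) u :=
  h.metric_lower hu (fun l => cfDelta Φ k (metricTensor Φ j l) u) m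

theorem dz_dEtaBar_energy (h : IsLocalFinsler Φ V) (hu : u ∈ V) (j m : Fin n) :
    dz j (dEtaBar m (energy Φ)) u = ∑ l, dz j (metricTensor Φ l m) u * u.2 l := by
  have hδ := localDerivation_dz h.isOpen j
  rw [← hδ.congr (fun w hw => h.sum_eta_metricTensor hw m) hu,
    hδ.sum_mul (fun i => contDiffOn_eta i) (fun i => h.contDiffOn_metricTensor i m) hu]
  exact Finset.sum_congr rfl fun l _ => by rw [dz_eta]; ring

/-- With its index lowered, N is a mixed second derivative of the energy, which makes its vertical
derivative computable. -/
theorem metric_cfN (h : IsLocalFinsler Φ V) (hu : u ∈ V) (j m : Fin n) :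
    ∑ k, metricTensor Φ k m u * cfN Φ k j u = dz j (dEtaBar m (energy Φ)) u := by
  rw [h.dz_dEtaBar_energy hu,
    ← h.metric_lower hu (fun p => ∑ l, dz j (metricTensor Φ l p) u * u.2 l) m]
  refine Finset.sum_congr rfl fun k _ => ?_
  simp only [cfN, Finset.mul_sum, mul_assoc]

/-- `∂N_jᵏ/∂η^q = Lᵏ_{qj}`. -/
theorem dEta_cfN (h : IsLocalFinsler Φ V) (hu : u ∈ V) (k j q : Fin n) :
    dEta q (cfN Φ k j) u = cfL Φ k q j u := by
  have hδ := localDerivation_dEta h.isOpen q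
  refine congrFun (h.metric_cancel hu (x := fun k => dEta q (cfN Φ k j) u)
    (y := fun k => cfL Φ k q j u) fun m => ?_) k
  have h1 := hδ.congr (fun w hw => h.metric_cfN hw j m) hu
  rw [hδ.sum_mul (fun k => h.contDiffOn_metricTensor k m) (fun k => h.contDiffOn_cfN k j) hu,
    h.dEta_dz_metric hu, Finset.sum_add_distrib] at h1
  rw [h.metric_cfL hu, cfDelta, ← h1, eq_sub_iff_add_eq, add_comm]
  congr 1
  -- The term in which the metric is differentiated is, by symmetry, the vertical part of δ_j acting
  -- on the metric.
  refine Finset.sum_congr rfl fun p _ => ?_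
  rw [h.dEta_metricTensor_comm hu, mul_comm]

theorem cfC_symm (h : IsLocalFinsler Φ V) (hu : u ∈ V) (i j k : Fin n) :
    cfC Φ i j k u = cfC Φ i k j u := by
  simp only [cfC, h.dEta_metricTensor_comm hu j k]

theorem sum_eta_cfC (h : IsLocalFinsler Φ V) (hu : u ∈ V) (i k : Fin n) :
    ∑ j, u.2 j * cfC Φ i j k u = 0 := by
  simp only [cfC, Finset.mul_sum]
  rw [Finset.sum_comm]
  refine Finset.sum_eq_zero fun l _ => ?_
  rw [← mul_zero (metricInv Φ l i u), ← h.sum_eta_dEta_metricTensor hu k l, Finset.mul_sum]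
  exact Finset.sum_congr rfl fun j _ => by ring

/-- `ηᵏ Lⁱ_{kj} = N_jⁱ`. -/
theorem sum_eta_cfL (h : IsLocalFinsler Φ V) (hu : u ∈ V) (i j : Fin n) :
    ∑ k, u.2 k * cfL Φ i k j u = cfN Φ i j u := by
  refine congrFun (h.metric_cancel hu (x := fun i => ∑ k, u.2 k * cfL Φ i k j u)
    (y := fun i => cfN Φ i j u) fun m => ?_) i
  rw [h.metric_cfN hu, h.dz_dEtaBar_energy hu]
  simp only [Finset.mul_sum]
  rw [Finset.sum_comm]
  have h1 : ∀ k, ∑ i, metricTensor Φ i m u * (u.2 k * cfL Φ i k j u)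
      = dz j (metricTensor Φ k m) u * u.2 k
        - ∑ p, cfN Φ p j u * (u.2 k * dEta p (metricTensor Φ k m) u) := by
    intro k
    have h2 := h.metric_cfL hu k j m
    rw [cfDelta] at h2
    calc _ = u.2 k * ∑ i, metricTensor Φ i m u * cfL Φ i k j u := by
          rw [Finset.mul_sum]; exact Finset.sum_congr rfl fun i _ => by ring
      _ = _ := by
          rw [h2, mul_sub, Finset.mul_sum, mul_comm]
          congr 1
          exact Finset.sum_congr rfl fun i _ => by ring
  simp only [h1, Finset.sum_sub_distrib]
  rw [Finset.sum_comm (f := fun k p => cfN Φ p j u * (u.2 k * dEta p (metricTensor Φ k m) u))]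
  simp only [← Finset.mul_sum, h.sum_eta_dEta_metricTensor hu, mul_zero, Finset.sum_const_zero,
    sub_zero]

/-! ### The canonical nonlinear connection and the Berwald and Rund type connections -/

theorem canN_eq (h : IsLocalFinsler Φ V) (hu : u ∈ V) (i j : Fin n) :
    canN Φ i j u = (1 / 2 : ℂ) * (cfN Φ i j u + ∑ l, cfL Φ i j l u * u.2 l) := by
  have hδ := localDerivation_dEta h.isOpen j
  have h1 : canN Φ i j u = dEta j (fun w => (1 / 2 : ℂ) * ∑ l, cfN Φ i l w * w.2 l) u := rfl
  rw [h1, hδ.const_mul (ContDiffOn.sum fun l _ => (h.contDiffOn_cfN i l).mul (contDiffOn_eta l))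
    _ hu, hδ.sum_mul (fun l => h.contDiffOn_cfN i l) (fun l => contDiffOn_eta l) hu]
  simp only [dEta_eta, h.dEta_cfN hu, Finset.sum_add_distrib, mul_ite, mul_one, mul_zero,
    Finset.sum_ite_eq', Finset.mem_univ, if_true]
  rw [add_comm]

theorem berwaldL_eq (h : IsLocalFinsler Φ V) (hu : u ∈ V) (i j k : Fin n) :
    berwaldL Φ i j k u = (1 / 2 : ℂ) * (cfL Φ i j k u + cfL Φ i k j u
      + ∑ l, u.2 l * dEta k (cfL Φ i j l) u) := by
  have hδ := localDerivation_dEta h.isOpen k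
  have hs : ContDiffOn ℝ ∞ (fun w => ∑ l, cfL Φ i j l w * w.2 l) V :=
    ContDiffOn.sum fun l _ => (h.contDiffOn_cfL i j l).mul (contDiffOn_eta l)
  rw [berwaldL, hδ.congr (fun w hw => h.canN_eq hw i j) hu,
    hδ.const_mul ((h.contDiffOn_cfN i j).add hs) _ hu, hδ.add (h.contDiffOn_cfN i j) hs u hu,
    hδ.sum_mul (fun l => h.contDiffOn_cfL i j l) (fun l => contDiffOn_eta l) hu, h.dEta_cfN hu]
  simp only [dEta_eta, Finset.sum_add_distrib, mul_ite, mul_one, mul_zero,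
    Finset.sum_ite_eq', Finset.mem_univ, if_true, mul_comm (u.2 _)]
  ring

/-- The difference `N - Nᶜ` of the Chern-Finsler and the canonical nonlinear connections. -/
noncomputable def diffN (Φ : Coord n × Coord n → ℝ) (i j : Fin n) (u : Coord n × Coord n) : ℂ :=
  cfN Φ i j u - canN Φ i j u

theorem canDelta_eq (k : Fin n) (f : Coord n × Coord n → ℂ) :
    canDelta Φ k f u = cfDelta Φ k f u + ∑ p, diffN Φ p k u * dEta p f u := by
  simp only [canDelta, cfDelta, diffN, sub_mul, Finset.sum_sub_distrib]
  ring

theorem sum_metricInv_canDelta (i j k : Fin n) :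
    ∑ l, metricInv Φ l i u * canDelta Φ k (metricTensor Φ j l) u
      = cfL Φ i j k u + ∑ p, diffN Φ p k u * cfC Φ i j p u := by
  simp only [canDelta_eq, mul_add, Finset.sum_add_distrib, cfL, cfC, Finset.mul_sum]
  congr 1
  rw [Finset.sum_comm]
  exact Finset.sum_congr rfl fun p _ => Finset.sum_congr rfl fun l _ => by ring

theorem rundL_eq (i j k : Fin n) :
    rundL Φ i j k u = (1 / 2 : ℂ) * (cfL Φ i j k u + cfL Φ i k j u
      + ∑ p, (diffN Φ p k u * cfC Φ i j p u + diffN Φ p j u * cfC Φ i k p u)) := by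
  simp only [rundL, mul_add, Finset.sum_add_distrib, sum_metricInv_canDelta]
  ring

/-- The symmetrized L is common to both connections and drops out. -/
theorem berwaldL_eq_rundL_iff (h : IsLocalFinsler Φ V) (hu : u ∈ V) (i j k : Fin n) :
    berwaldL Φ i j k u = rundL Φ i j k u ↔ ∑ l, u.2 l * dEta k (cfL Φ i j l) u
      = ∑ p, (diffN Φ p k u * cfC Φ i j p u + diffN Φ p j u * cfC Φ i k p u) := by
  rw [h.berwaldL_eq hu, rundL_eq]
  constructor
  · intro h1; linear_combination 2 * h1
  · intro h1; linear_combination (1 / 2 : ℂ) * h1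

/-- Contracted with η, both nonlinear connections give `2G`. -/
theorem sum_diffN_eta (h : IsLocalFinsler Φ V) (hu : u ∈ V) (i : Fin n) :
    ∑ j, u.2 j * diffN Φ i j u = 0 := by
  have h1 : ∑ j, u.2 j * ∑ l, cfL Φ i j l u * u.2 l = ∑ l, u.2 l * cfN Φ i l u := by
    simp only [← h.sum_eta_cfL hu, Finset.mul_sum]
    rw [Finset.sum_comm]
    exact Finset.sum_congr rfl fun p _ => Finset.sum_congr rfl fun l _ => by ring
  have h2 : ∀ j, u.2 j * diffN Φ i j u
      = (1 / 2 : ℂ) * (u.2 j * cfN Φ i j u - u.2 j * ∑ l, cfL Φ i j l u * u.2 l) := by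
    intro j; rw [diffN, h.canN_eq hu]; ring
  simp only [h2, ← Finset.mul_sum, Finset.sum_sub_distrib, h1, sub_self, mul_zero]

/-! ### The horizontal derivative of the vertical coefficients -/

/-- The connection matrix `Γⁱ_j = Lⁱ_{jk} ηᵏ` of the derivative along `η`. -/
noncomputable def radialL (Φ : Coord n × Coord n → ℝ) (i j : Fin n) (u : Coord n × Coord n) : ℂ :=
  ∑ k, u.2 k * cfL Φ i j k u

/-- `Cⁱ_{jk|0}`. -/
noncomputable def covC (Φ : Coord n × Coord n → ℝ) (i j k : Fin n) (u : Coord n × Coord n) : ℂ :=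
  hcov0 Φ (cfC Φ i j k) u + ∑ q, (radialL Φ i q u * cfC Φ q j k u
    - cfC Φ i q k u * radialL Φ q j u - radialL Φ q k u * cfC Φ i j q u)

/-- The commutator of ∂/∂ηᵏ with δ_l is `-Lᵖ_{kl} ∂/∂ηᵖ`, since ∂N/∂η is L. -/
theorem cfDelta_dEta_metric (h : IsLocalFinsler Φ V) (hu : u ∈ V) (j k l m : Fin n) :
    dEta k (cfDelta Φ l (metricTensor Φ j m)) u = cfDelta Φ l (dEta k (metricTensor Φ j m)) u
      - ∑ p, cfL Φ p k l u * dEta p (metricTensor Φ j m) u := by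
  have hδ := localDerivation_dEta h.isOpen k
  have hg := h.contDiffOn_metricTensor j m
  have hd : ∀ p, ContDiffOn ℝ ∞ (dEta p (metricTensor Φ j m)) V := fun p =>
    (localDerivation_dEta h.isOpen p).smooth hg
  have h1 : cfDelta Φ l (metricTensor Φ j m) = fun w => dz l (metricTensor Φ j m) w
    - ∑ p, cfN Φ p l w * dEta p (metricTensor Φ j m) w := rfl
  rw [h1, hδ.sub ((localDerivation_dz h.isOpen l).smooth hg)
    (ContDiffOn.sum fun p _ => (h.contDiffOn_cfN p l).mul (hd p)) hu,
    hδ.sum_mul (fun p => h.contDiffOn_cfN p l) hd hu, dEta_dz_comm h.isOpen hg hu, cfDelta]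
  simp only [h.dEta_cfN hu, Finset.sum_add_distrib, dEta_dEta_comm h.isOpen hg hu k]
  ring

/-- The right side is the covariant derivative `Cⁱ_{jk|l}`. With indices lowered, L and C are the
horizontal and vertical derivatives of the metric, so the commutator of these derivations links
∂L/∂η to δC. -/
theorem dEta_cfL (h : IsLocalFinsler Φ V) (hu : u ∈ V) (i j k l : Fin n) :
    dEta k (cfL Φ i j l) u = cfDelta Φ l (cfC Φ i j k) u + ∑ q, (cfL Φ i q l u * cfC Φ q j k u
      - cfC Φ i q k u * cfL Φ q j l u - cfL Φ q k l u * cfC Φ i j q u) := by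
  refine congrFun (h.metric_cancel hu (x := fun i => dEta k (cfL Φ i j l) u)
    (y := fun i => cfDelta Φ l (cfC Φ i j k) u + ∑ q, (cfL Φ i q l u * cfC Φ q j k u
      - cfC Φ i q k u * cfL Φ q j l u - cfL Φ q k l u * cfC Φ i j q u)) fun m => ?_) i
  have hδ := localDerivation_dEta h.isOpen k
  have hΔ := h.localDerivation_cfDelta l
  have h1 := hδ.congr (fun w hw => h.metric_cfL hw j l m) hu
  have h2 := hΔ.congr (fun w hw => h.metric_cfC hw j k m) hu
  rw [hδ.sum_mul (fun i => h.contDiffOn_metricTensor i m) (fun i => h.contDiffOn_cfL i j l) hu,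
    h.cfDelta_dEta_metric hu, ← h2,
    hΔ.sum_mul (fun i => h.contDiffOn_metricTensor i m) (fun i => h.contDiffOn_cfC i j k) hu] at h1
  simp only [← h.metric_cfL hu, ← h.metric_cfC hu, Finset.sum_add_distrib] at h1
  have e1 : ∑ i, (∑ q, metricTensor Φ q m u * cfC Φ q i k u) * cfL Φ i j l u
      = ∑ i, metricTensor Φ i m u * ∑ q, cfC Φ i q k u * cfL Φ q j l u := by
    simp only [Finset.mul_sum, Finset.sum_mul]
    rw [Finset.sum_comm]
    simp only [mul_assoc]
  have e2 : ∑ i, (∑ q, metricTensor Φ q m u * cfL Φ q i l u) * cfC Φ i j k u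
      = ∑ i, metricTensor Φ i m u * ∑ q, cfL Φ i q l u * cfC Φ q j k u := by
    simp only [Finset.mul_sum, Finset.sum_mul]
    rw [Finset.sum_comm]
    simp only [mul_assoc]
  have e3 : ∑ p, cfL Φ p k l u * ∑ q, metricTensor Φ q m u * cfC Φ q j p u
      = ∑ i, metricTensor Φ i m u * ∑ q, cfL Φ q k l u * cfC Φ i j q u := by
    simp only [Finset.mul_sum]
    rw [Finset.sum_comm]
    exact Finset.sum_congr rfl fun p _ => Finset.sum_congr rfl fun l _ => by ring
  rw [e1, e2, e3] at h1
  simp only [mul_add, mul_sub, Finset.sum_add_distrib, Finset.sum_sub_distrib]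
  linear_combination h1

theorem sum_eta_dEta_cfL (h : IsLocalFinsler Φ V) (hu : u ∈ V) (i j k : Fin n) :
    ∑ l, u.2 l * dEta k (cfL Φ i j l) u = covC Φ i j k u := by
  simp only [h.dEta_cfL hu, covC, hcov0, radialL, mul_add, Finset.sum_add_distrib]
  congr 1
  simp only [Finset.mul_sum, Finset.sum_mul, ← Finset.sum_sub_distrib]
  rw [Finset.sum_comm]
  exact Finset.sum_congr rfl fun p _ => Finset.sum_congr rfl fun l _ => by ring

/-- Both sides are second vertical derivatives of the same coefficient of N. -/
theorem dEta_cfL_comm (h : IsLocalFinsler Φ V) (hu : u ∈ V) (i j k l : Fin n) :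
    dEta k (cfL Φ i j l) u = dEta j (cfL Φ i k l) u := by
  have h1 : ∀ q, Set.EqOn (dEta q (cfN Φ i l)) (cfL Φ i q l) V := fun q w hw => h.dEta_cfN hw i l q
  rw [← (localDerivation_dEta h.isOpen k).congr (h1 j) hu,
    ← (localDerivation_dEta h.isOpen j).congr (h1 k) hu]
  exact dEta_dEta_comm h.isOpen (h.contDiffOn_cfN i l) hu k j

theorem covC_symm (h : IsLocalFinsler Φ V) (hu : u ∈ V) (i j k : Fin n) :
    covC Φ i j k u = covC Φ i k j u := by
  simp only [← h.sum_eta_dEta_cfL hu, h.dEta_cfL_comm hu i j k]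

/-- Differentiating `ηʲ Lⁱ_{jl} = N_lⁱ` by ηᵏ yields `Lⁱ_{kl}` on both sides, so the remaining term
vanishes. -/
theorem sum_eta_covC (h : IsLocalFinsler Φ V) (hu : u ∈ V) (i k : Fin n) :
    ∑ j, u.2 j * covC Φ i j k u = 0 := by
  simp only [← h.sum_eta_dEta_cfL hu, Finset.mul_sum]
  rw [Finset.sum_comm]
  refine Finset.sum_eq_zero fun l _ => ?_
  have hδ := localDerivation_dEta h.isOpen k
  have h1 := hδ.congr (fun w hw => h.sum_eta_cfL hw i l) hu
  rw [hδ.sum_mul (fun j => contDiffOn_eta j) (fun j => h.contDiffOn_cfL i j l) hu,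
    h.dEta_cfN hu] at h1
  simp only [dEta_eta, Finset.sum_add_distrib, ite_mul, one_mul, zero_mul, Finset.sum_ite_eq',
    Finset.mem_univ, if_true] at h1
  rw [← mul_zero (u.2 l), ← add_eq_left.1 h1, Finset.mul_sum]
  exact Finset.sum_congr rfl fun j _ => by ring

end IsLocalFinsler

end ComplexFinsler

namespace ComplexFinsler

namespace IsLocalFinsler

section Radial

variable {n : ℕ} {Φ : Coord n × Coord n → ℝ} {V : Set (Coord n × Coord n)}
  {u : Coord n × Coord n}

/-! ### The horizontal derivative along `η` -/

theorem hcov0_metricTensor (h : IsLocalFinsler Φ V) (hu : u ∈ V) (j m : Fin n) :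
    hcov0 Φ (metricTensor Φ j m) u = ∑ i, radialL Φ i j u * metricTensor Φ i m u := by
  simp only [hcov0, ← h.metric_cfL hu, radialL, Finset.mul_sum, Finset.sum_mul]
  rw [Finset.sum_comm]
  exact Finset.sum_congr rfl fun p _ => Finset.sum_congr rfl fun l _ => by ring

/-- This says that η is parallel along itself: `δ_k ηⁱ = -N_kⁱ`, and N is L contracted with η. -/
theorem hcov0_eta (h : IsLocalFinsler Φ V) (hu : u ∈ V) (i : Fin n) :
    hcov0 Φ (fun w => w.2 i) u = -∑ j, radialL Φ i j u * u.2 j := by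
  simp only [hcov0, cfDelta, dz_eta, dEta_eta, mul_ite, mul_one, mul_zero, Finset.sum_ite_eq,
    Finset.mem_univ, if_true, zero_sub, ← h.sum_eta_cfL hu, radialL, Finset.sum_mul,
    Finset.mul_sum, mul_neg, Finset.sum_neg_distrib]
  rw [Finset.sum_comm]
  congr 1
  exact Finset.sum_congr rfl fun p _ => Finset.sum_congr rfl fun l _ => by ring

theorem hcov0_etaConj (i : Fin n) : hcov0 Φ (fun w => (starRingEnd ℂ) (w.2 i)) u = 0 := by
  simp only [hcov0, cfDelta, dz_etaConj, dEta_etaConj, mul_zero, Finset.sum_const_zero, sub_zero]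

/-- Each δ_k already annihilates the energy: by Euler's identity and the lowered form of N, ∂L/∂zᵏ
equals `N_kᵖ ∂L/∂ηᵖ`. -/
theorem hcov0_energy (h : IsLocalFinsler Φ V) (hu : u ∈ V) : hcov0 Φ (energy Φ) u = 0 := by
  refine Finset.sum_eq_zero fun k _ => ?_
  have hδ := localDerivation_dz h.isOpen k
  have h1 := hδ.congr (fun w hw => h.sum_etaConj_dEtaBar_energy hw) hu
  rw [hδ.sum_mul (fun i => contDiffOn_etaConj i) h.contDiffOn_dEtaBar_energy hu] at h1
  simp only [dz_etaConj, zero_mul, zero_add, ← h.metric_cfN hu, Finset.mul_sum] at h1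
  rw [cfDelta, ← h1, Finset.sum_comm]
  simp only [← h.sum_metricTensor_etaConj hu, Finset.mul_sum]
  rw [sub_eq_zero.2, mul_zero]
  exact Finset.sum_congr rfl fun p _ => Finset.sum_congr rfl fun l _ => by ring

theorem norm_ne_zero (h : IsLocalFinsler Φ V) (hu : u ∈ V) : (Φ u : ℂ) ≠ 0 :=
  Complex.ofReal_ne_zero.2 (h.pos hu).ne'

theorem hcov0_norm (h : IsLocalFinsler Φ V) (hu : u ∈ V) :
    hcov0 Φ (fun w => (Φ w : ℂ)) u = 0 := by
  have h1 := h.hcov0_energy hu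
  have h2 : energy Φ = fun w => (Φ w : ℂ) * (Φ w : ℂ) := by
    funext w; simp [energy, sq]
  rw [h2, h.localDerivation_hcov0.mul h.contDiffOn_norm h.contDiffOn_norm u hu] at h1
  have h3 : (2 * (Φ u : ℂ)) * hcov0 Φ (fun w => (Φ w : ℂ)) u = 0 := by
    linear_combination h1
  exact (mul_eq_zero.1 h3).resolve_left (mul_ne_zero two_ne_zero (h.norm_ne_zero hu))

end Radial

/-! ### The Berwald frame in dimension two -/

section Frame

variable {Φ : Coord 2 × Coord 2 → ℝ} {V : Set (Coord 2 × Coord 2)} {u : Coord 2 × Coord 2}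

theorem norm_mul_lUp (h : IsLocalFinsler Φ V) (hu : u ∈ V) (i : Fin 2) :
    (Φ u : ℂ) * lUp Φ i u = u.2 i := by
  rw [lUp, mul_div_cancel₀ _ (h.norm_ne_zero hu)]

theorem contDiffOn_lUp (h : IsLocalFinsler Φ V) (i : Fin 2) : ContDiffOn ℝ ∞ (lUp Φ i) V :=
  ((contDiffOn_eta i).mul (h.contDiffOn_norm.inv fun _ hw => h.norm_ne_zero hw)).congr
    fun _ _ => div_eq_mul_inv _ _

theorem norm_mul_lDown (h : IsLocalFinsler Φ V) (hu : u ∈ V) (i : Fin 2) :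
    (Φ u : ℂ) * lDown Φ i u = ∑ m, metricTensor Φ i m u * (starRingEnd ℂ) (u.2 m) := by
  simp only [lDown, Finset.mul_sum, ← h.norm_mul_lUp hu, map_mul, Complex.conj_ofReal]
  exact Finset.sum_congr rfl fun m _ => by ring

theorem contDiffOn_lDown (h : IsLocalFinsler Φ V) (i : Fin 2) :
    ContDiffOn ℝ ∞ (lDown Φ i) V :=
  ContDiffOn.sum fun j _ => (h.contDiffOn_metricTensor i j).mul
    (Complex.conjCLE.contDiff.comp_contDiffOn (h.contDiffOn_lUp j))

theorem det_pos (h : IsLocalFinsler Φ V) (hu : u ∈ V) : 0 < (metricMatrix Φ u).det :=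
  (h.posDef u hu).det_pos

theorem sqrtDet_mul_self (h : IsLocalFinsler Φ V) (hu : u ∈ V) :
    (sqrtDet Φ u : ℂ) * sqrtDet Φ u = metricTensor Φ 0 0 u * metricTensor Φ 1 1 u
      - metricTensor Φ 0 1 u * metricTensor Φ 1 0 u := by
  have h1 := Complex.pos_iff.1 (h.det_pos hu)
  rw [← Complex.ofReal_mul, sqrtDet, Real.mul_self_sqrt h1.1.le]
  have h2 : (((metricMatrix Φ u).det.re : ℝ) : ℂ) = (metricMatrix Φ u).det :=
    Complex.ext rfl h1.2
  rw [h2, Matrix.det_fin_two]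
  rfl

theorem sqrtDet_pos (h : IsLocalFinsler Φ V) (hu : u ∈ V) : 0 < sqrtDet Φ u :=
  Real.sqrt_pos.2 (Complex.pos_iff.1 (h.det_pos hu)).1

theorem sqrtDet_ne_zero (h : IsLocalFinsler Φ V) (hu : u ∈ V) : (sqrtDet Φ u : ℂ) ≠ 0 :=
  Complex.ofReal_ne_zero.2 (h.sqrtDet_pos hu).ne'

theorem contDiffOn_sqrtDet (h : IsLocalFinsler Φ V) :
    ContDiffOn ℝ ∞ (fun w => (sqrtDet Φ w : ℂ)) V := by
  have h1 : ContDiffOn ℝ ∞ (fun w => (metricMatrix Φ w).det) V :=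
    contDiffOn_det fun i j => h.contDiffOn_metricTensor i j
  exact Complex.ofRealCLM.contDiff.comp_contDiffOn
    ((Complex.reCLM.contDiff.comp_contDiffOn h1).sqrt
      fun w hw => (Complex.pos_iff.1 (h.det_pos hw)).1.ne')

theorem sqrtDet_mul_mUp_zero (h : IsLocalFinsler Φ V) (hu : u ∈ V) :
    (sqrtDet Φ u : ℂ) * mUp Φ 0 u = -lDown Φ 1 u := by
  rw [mUp, mul_div_cancel₀ _ (h.sqrtDet_ne_zero hu)]; rfl

theorem sqrtDet_mul_mUp_one (h : IsLocalFinsler Φ V) (hu : u ∈ V) :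
    (sqrtDet Φ u : ℂ) * mUp Φ 1 u = lDown Φ 0 u := by
  rw [mUp, mul_div_cancel₀ _ (h.sqrtDet_ne_zero hu)]; rfl

theorem contDiffOn_mUp (h : IsLocalFinsler Φ V) (i : Fin 2) : ContDiffOn ℝ ∞ (mUp Φ i) V := by
  have hs := fun w hw => h.sqrtDet_ne_zero (u := w) hw
  fin_cases i
  · exact ((h.contDiffOn_lDown 1).neg.mul (h.contDiffOn_sqrtDet.inv hs)).congr
      fun _ _ => div_eq_mul_inv _ _
  · exact ((h.contDiffOn_lDown 0).mul (h.contDiffOn_sqrtDet.inv hs)).congr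
      fun _ _ => div_eq_mul_inv _ _

theorem conj_metricTensor (h : IsLocalFinsler Φ V) (hu : u ∈ V) (i j : Fin 2) :
    (starRingEnd ℂ) (metricTensor Φ i j u) = metricTensor Φ j i u :=
  (h.posDef u hu).1.apply j i

theorem conj_lDown (h : IsLocalFinsler Φ V) (hu : u ∈ V) (i : Fin 2) :
    (starRingEnd ℂ) (lDown Φ i u) = ∑ j, metricTensor Φ j i u * lUp Φ j u := by
  simp only [lDown, map_sum, map_mul, h.conj_metricTensor hu, Complex.conj_conj]

theorem sqrtDet_mul_mDown (h : IsLocalFinsler Φ V) (hu : u ∈ V) (i : Fin 2) :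
    (sqrtDet Φ u : ℂ) * mDown Φ i u = metricTensor Φ i 1 u * (starRingEnd ℂ) (lDown Φ 0 u)
      - metricTensor Φ i 0 u * (starRingEnd ℂ) (lDown Φ 1 u) := by
  have h0 := congrArg (starRingEnd ℂ) (h.sqrtDet_mul_mUp_zero hu)
  have h1 := congrArg (starRingEnd ℂ) (h.sqrtDet_mul_mUp_one hu)
  rw [map_mul, Complex.conj_ofReal] at h0 h1
  rw [map_neg] at h0
  rw [mDown, Fin.sum_univ_two]
  linear_combination metricTensor Φ i 0 u * h0 + metricTensor Φ i 1 u * h1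

/-- Lowering the conjugate of m produces the determinant of the metric, of which one square root
cancels. -/
theorem mDown_zero (h : IsLocalFinsler Φ V) (hu : u ∈ V) :
    mDown Φ 0 u = -((sqrtDet Φ u : ℂ) * lUp Φ 1 u) := by
  apply mul_left_cancel₀ (h.sqrtDet_ne_zero hu)
  rw [h.sqrtDet_mul_mDown hu, h.conj_lDown hu, h.conj_lDown hu, Fin.sum_univ_two,
    Fin.sum_univ_two]
  linear_combination lUp Φ 1 u * h.sqrtDet_mul_self hu

theorem mDown_one (h : IsLocalFinsler Φ V) (hu : u ∈ V) :
    mDown Φ 1 u = (sqrtDet Φ u : ℂ) * lUp Φ 0 u := by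
  apply mul_left_cancel₀ (h.sqrtDet_ne_zero hu)
  rw [h.sqrtDet_mul_mDown hu, h.conj_lDown hu, h.conj_lDown hu, Fin.sum_univ_two,
    Fin.sum_univ_two]
  linear_combination -lUp Φ 0 u * h.sqrtDet_mul_self hu

/-- Euler's identity divided by F², because `∂L/∂ηⁱ = F l_i`. -/
theorem lDown_lUp (h : IsLocalFinsler Φ V) (hu : u ∈ V) :
    lDown Φ 0 u * lUp Φ 0 u + lDown Φ 1 u * lUp Φ 1 u = 1 := by
  have h0 := h.norm_ne_zero hu
  apply mul_left_cancel₀ (mul_ne_zero h0 h0)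
  have h1 := h.sum_eta_dEta_energy hu
  have h2 : ∀ i, dEta i (energy Φ) u = (Φ u : ℂ) * lDown Φ i u := fun i => by
    rw [h.norm_mul_lDown hu, ← h.sum_metricTensor_etaConj hu]
    exact Finset.sum_congr rfl fun m _ => mul_comm _ _
  have h3 : energy Φ u = (Φ u : ℂ) * Φ u := by simp [energy, sq]
  rw [Fin.sum_univ_two, h2, h2, h3, ← h.norm_mul_lUp hu, ← h.norm_mul_lUp hu] at h1
  linear_combination h1

theorem lDown_mUp (h : IsLocalFinsler Φ V) (hu : u ∈ V) :
    lDown Φ 0 u * mUp Φ 0 u + lDown Φ 1 u * mUp Φ 1 u = 0 := by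
  apply mul_left_cancel₀ (h.sqrtDet_ne_zero hu)
  linear_combination lDown Φ 0 u * h.sqrtDet_mul_mUp_zero hu
    + lDown Φ 1 u * h.sqrtDet_mul_mUp_one hu

theorem mDown_lUp (h : IsLocalFinsler Φ V) (hu : u ∈ V) :
    mDown Φ 0 u * lUp Φ 0 u + mDown Φ 1 u * lUp Φ 1 u = 0 := by
  rw [h.mDown_zero hu, h.mDown_one hu]; ring

theorem mDown_mUp (h : IsLocalFinsler Φ V) (hu : u ∈ V) :
    mDown Φ 0 u * mUp Φ 0 u + mDown Φ 1 u * mUp Φ 1 u = 1 := by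
  rw [h.mDown_zero hu, h.mDown_one hu]
  linear_combination -lUp Φ 1 u * h.sqrtDet_mul_mUp_zero hu
    + lUp Φ 0 u * h.sqrtDet_mul_mUp_one hu + h.lDown_lUp hu

/-- The frame `(l, m)` and the coframe are dual: `lᵖ l_q + mᵖ m_q = δᵖ_q`. -/
theorem frame_complete (h : IsLocalFinsler Φ V) (hu : u ∈ V) (p q : Fin 2) :
    lUp Φ p u * lDown Φ q u + mUp Φ p u * mDown Φ q u = if p = q then 1 else 0 := by
  have e0 := h.sqrtDet_mul_mUp_zero hu
  have e1 := h.sqrtDet_mul_mUp_one hu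
  have e := h.lDown_lUp hu
  fin_cases p <;> fin_cases q <;>
    simp only [Fin.zero_eta, Fin.mk_one, h.mDown_zero hu, h.mDown_one hu, if_true, Fin.isValue,
      zero_ne_one, one_ne_zero, if_false]
  · linear_combination e - lUp Φ 1 u * e0
  · linear_combination lUp Φ 0 u * e0
  · linear_combination -lUp Φ 1 u * e1
  · linear_combination e + lUp Φ 0 u * e1

theorem covector_eq (h : IsLocalFinsler Φ V) (hu : u ∈ V) (x : Fin 2 → ℂ) (q : Fin 2) :
    x q = (∑ p, x p * lUp Φ p u) * lDown Φ q u + (∑ p, x p * mUp Φ p u) * mDown Φ q u := by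
  have h1 : ∑ p, x p * (lUp Φ p u * lDown Φ q u + mUp Φ p u * mDown Φ q u) = x q := by
    simp [h.frame_complete hu]
  rw [← h1]
  simp only [mul_add, Finset.sum_add_distrib, Finset.sum_mul, mul_assoc]

theorem vector_eq (h : IsLocalFinsler Φ V) (hu : u ∈ V) (x : Fin 2 → ℂ) (p : Fin 2) :
    x p = (∑ q, lDown Φ q u * x q) * lUp Φ p u + (∑ q, mDown Φ q u * x q) * mUp Φ p u := by
  have h1 : ∑ q, (lUp Φ p u * lDown Φ q u + mUp Φ p u * mDown Φ q u) * x q = x p := by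
    simp [h.frame_complete hu]
  rw [← h1]
  simp only [add_mul, Finset.sum_add_distrib, Finset.sum_mul]
  congr 1 <;> exact Finset.sum_congr rfl fun _ _ => by ring

/-! ### Horizontal derivatives of the frame -/

theorem hcov0_lUp (h : IsLocalFinsler Φ V) (hu : u ∈ V) (i : Fin 2) :
    hcov0 Φ (lUp Φ i) u = -∑ j, radialL Φ i j u * lUp Φ j u := by
  have hδ := h.localDerivation_hcov0
  have h1 := hδ.congr (fun w hw => h.norm_mul_lUp hw i) hu
  rw [hδ.mul h.contDiffOn_norm (h.contDiffOn_lUp i) u hu, h.hcov0_norm hu, h.hcov0_eta hu] at h1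
  apply mul_left_cancel₀ (h.norm_ne_zero hu)
  simp only [← h.norm_mul_lUp hu, Fin.sum_univ_two] at h1 ⊢
  linear_combination h1

theorem hcov0_lDown (h : IsLocalFinsler Φ V) (hu : u ∈ V) (i : Fin 2) :
    hcov0 Φ (lDown Φ i) u = ∑ p, radialL Φ p i u * lDown Φ p u := by
  have hδ := h.localDerivation_hcov0
  have h1 := hδ.congr (fun w hw => h.norm_mul_lDown hw i) hu
  rw [hδ.mul h.contDiffOn_norm (h.contDiffOn_lDown i) u hu, h.hcov0_norm hu,
    hδ.sum_mul (fun m => h.contDiffOn_metricTensor i m) (fun m => contDiffOn_etaConj m) hu] at h1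
  apply mul_left_cancel₀ (h.norm_ne_zero hu)
  have h2 := h.norm_mul_lDown hu
  simp only [h.hcov0_metricTensor hu, hcov0_etaConj, Fin.sum_univ_two] at h1 h2 ⊢
  linear_combination h1 - radialL Φ 0 i u * h2 0 - radialL Φ 1 i u * h2 1

/-- Jacobi's formula gives logarithmic derivative tr Γ for the determinant; the square root halves
it. -/
theorem hcov0_sqrtDet (h : IsLocalFinsler Φ V) (hu : u ∈ V) :
    hcov0 Φ (fun w => (sqrtDet Φ w : ℂ)) u
      = (1 / 2 : ℂ) * (radialL Φ 0 0 u + radialL Φ 1 1 u) * sqrtDet Φ u := by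
  have hδ := h.localDerivation_hcov0
  have hg := h.contDiffOn_metricTensor
  have h1 := hδ.congr (fun w hw => h.sqrtDet_mul_self hw) hu
  rw [hδ.mul h.contDiffOn_sqrtDet h.contDiffOn_sqrtDet u hu,
    hδ.sub ((hg 0 0).mul (hg 1 1)) ((hg 0 1).mul (hg 1 0)) hu, hδ.mul (hg 0 0) (hg 1 1) u hu,
    hδ.mul (hg 0 1) (hg 1 0) u hu] at h1
  simp only [h.hcov0_metricTensor hu, Fin.sum_univ_two] at h1
  apply mul_left_cancel₀ (mul_ne_zero two_ne_zero (h.sqrtDet_ne_zero hu))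
  linear_combination h1 - (radialL Φ 0 0 u + radialL Φ 1 1 u) * h.sqrtDet_mul_self hu

/-- The rotated covector `(-l₂, l₁)` is transported by the adjugate `tr Γ - Γ`. Dividing by √g
removes half of the trace. -/
theorem hcov0_mUp (h : IsLocalFinsler Φ V) (hu : u ∈ V) (i : Fin 2) :
    hcov0 Φ (mUp Φ i) u = (1 / 2 : ℂ) * (radialL Φ 0 0 u + radialL Φ 1 1 u) * mUp Φ i u
      - ∑ j, radialL Φ i j u * mUp Φ j u := by
  have hδ := h.localDerivation_hcov0
  have hs := h.contDiffOn_sqrtDet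
  have e0 := h.sqrtDet_mul_mUp_zero hu
  have e1 := h.sqrtDet_mul_mUp_one hu
  have h0 := hδ.congr (fun w hw => h.sqrtDet_mul_mUp_zero hw) hu
  have h1 := hδ.congr (fun w hw => h.sqrtDet_mul_mUp_one hw) hu
  rw [hδ.mul hs (h.contDiffOn_mUp 0) u hu, hδ.neg (h.contDiffOn_lDown 1) hu] at h0
  rw [hδ.mul hs (h.contDiffOn_mUp 1) u hu] at h1
  simp only [h.hcov0_sqrtDet hu, h.hcov0_lDown hu, Fin.sum_univ_two] at h0 h1
  apply mul_left_cancel₀ (h.sqrtDet_ne_zero hu)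
  fin_cases i <;> simp only [Fin.zero_eta, Fin.mk_one, Fin.isValue, Fin.sum_univ_two]
  · linear_combination h0 + radialL Φ 0 1 u * e1 - radialL Φ 1 1 u * e0
  · linear_combination h1 - radialL Φ 0 0 u * e1 + radialL Φ 1 0 u * e0

/-! ### The invariants `A`, `B` and the connection invariants -/

theorem contDiffOn_coeffA (h : IsLocalFinsler Φ V) : ContDiffOn ℝ ∞ (coeffA Φ) V :=
  ContDiffOn.sum fun j _ => ContDiffOn.sum fun k _ => ContDiffOn.sum fun i _ =>
    (((h.contDiffOn_mUp j).mul (h.contDiffOn_mUp k)).mul (h.contDiffOn_lDown i)).mul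
      (h.contDiffOn_cfC i k j)

theorem contDiffOn_mDown (h : IsLocalFinsler Φ V) (i : Fin 2) :
    ContDiffOn ℝ ∞ (mDown Φ i) V :=
  ContDiffOn.sum fun j _ => (h.contDiffOn_metricTensor i j).mul
    (Complex.conjCLE.contDiff.comp_contDiffOn (h.contDiffOn_mUp j))

theorem contDiffOn_coeffB (h : IsLocalFinsler Φ V) : ContDiffOn ℝ ∞ (coeffB Φ) V :=
  ContDiffOn.sum fun j _ => ContDiffOn.sum fun k _ => ContDiffOn.sum fun i _ =>
    (((h.contDiffOn_mDown i).mul (h.contDiffOn_mUp k)).mul (h.contDiffOn_mUp j)).mul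
      (h.contDiffOn_cfC i j k)

/-- `Cⁱ_{jk} mʲ mᵏ = A lⁱ + B mⁱ`. -/
theorem cfC_mUp_mUp (h : IsLocalFinsler Φ V) (hu : u ∈ V) (i : Fin 2) :
    ∑ j, (∑ k, cfC Φ i j k u * mUp Φ k u) * mUp Φ j u
      = coeffA Φ u * lUp Φ i u + coeffB Φ u * mUp Φ i u := by
  rw [h.vector_eq hu (fun i => ∑ j, (∑ k, cfC Φ i j k u * mUp Φ k u) * mUp Φ j u) i]
  congr 2
  · simp only [coeffA, Fin.sum_univ_two]; ring
  · simp only [coeffB, Fin.sum_univ_two]; ring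

theorem radialL_trace (h : IsLocalFinsler Φ V) (hu : u ∈ V) :
    radialL Φ 0 0 u + radialL Φ 1 1 u = (Φ u : ℂ) * (coeffJ Φ u + coeffY Φ u) := by
  -- J and Y are the diagonal entries in the frame (l, m), so completeness of the frame turns their
  -- sum into a trace.
  have h1 : coeffJ Φ u + coeffY Φ u = ∑ j, ∑ k, ∑ i,
      (lUp Φ j u * lDown Φ i u + mUp Φ j u * mDown Φ i u) * (lUp Φ k u * cfL Φ i j k u) := by
    simp only [coeffJ, coeffY, Fin.sum_univ_two]; ring
  rw [h1]
  simp only [h.frame_complete hu, radialL, ite_mul, one_mul, zero_mul, Finset.sum_ite_eq,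
    Finset.mem_univ, if_true, ← h.norm_mul_lUp hu, Fin.sum_univ_two]
  ring

/-- `m_p (N - Nᶜ)ᵖ_k mᵏ = F (E - Y) / 2`. -/
theorem mDown_diffN_mUp (h : IsLocalFinsler Φ V) (hu : u ∈ V) :
    ∑ p, mDown Φ p u * ∑ k, diffN Φ p k u * mUp Φ k u
      = (1 / 2 : ℂ) * ((Φ u : ℂ) * (coeffE Φ u - coeffY Φ u)) := by
  -- On m, N contributes `F E`, while the canonical connection averages `F E` and `F Y`.
  simp only [diffN, h.canN_eq hu, ← h.sum_eta_cfL hu, coeffE, coeffY, ← h.norm_mul_lUp hu,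
    Fin.sum_univ_two]
  ring

/-- `Cⁱ_{jk} mʲ = (A lⁱ + B mⁱ) m_k`. -/
theorem cfC_mUp (h : IsLocalFinsler Φ V) (hu : u ∈ V) (i k : Fin 2) :
    ∑ j, cfC Φ i j k u * mUp Φ j u
      = (coeffA Φ u * lUp Φ i u + coeffB Φ u * mUp Φ i u) * mDown Φ k u := by
  have h1 : ∀ j, ∑ p, cfC Φ i j p u * lUp Φ p u = 0 := fun j => by
    apply mul_left_cancel₀ (h.norm_ne_zero hu)
    rw [mul_zero, ← h.sum_eta_cfC hu i j, Finset.mul_sum]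
    refine Finset.sum_congr rfl fun p _ => ?_
    rw [← h.norm_mul_lUp hu, h.cfC_symm hu i j p]; ring
  have h2 := h1 0
  have h3 := h1 1
  have h4 := h.cfC_mUp_mUp hu i
  -- C annihilates l, so in this expansion only the m_k component survives.
  have h5 := h.covector_eq hu (fun k => ∑ j, cfC Φ i j k u * mUp Φ j u) k
  simp only [Fin.sum_univ_two] at h2 h3 h4 h5 ⊢
  linear_combination h5 + mUp Φ 0 u * lDown Φ k u * h2 + mUp Φ 1 u * lDown Φ k u * h3
    + mDown Φ k u * h4

/-- `Cⁱ_{jk|0} mʲ mᵏ` in the frame. -/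
theorem covC_mUp_mUp (h : IsLocalFinsler Φ V) (hu : u ∈ V) (i : Fin 2) :
    ∑ j, (∑ k, covC Φ i j k u * mUp Φ k u) * mUp Φ j u
      = (hcov0 Φ (coeffA Φ) u - (Φ u : ℂ) * coeffA Φ u * (coeffJ Φ u + coeffY Φ u)) * lUp Φ i u
      + (hcov0 Φ (coeffB Φ) u - (Φ u : ℂ) * coeffB Φ u / 2 * (coeffJ Φ u + coeffY Φ u))
        * mUp Φ i u := by
  have hδ := h.localDerivation_hcov0
  have hm := h.contDiffOn_mUp
  have hC := h.contDiffOn_cfC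
  have h1 := hδ.congr (fun w hw => h.cfC_mUp_mUp hw i) hu
  rw [hδ.sum_mul (fun j => ContDiffOn.sum fun k _ => (hC i j k).mul (hm k)) hm hu,
    hδ.add (h.contDiffOn_coeffA.mul (h.contDiffOn_lUp i))
      (h.contDiffOn_coeffB.mul (hm i)) u hu,
    hδ.mul h.contDiffOn_coeffA (h.contDiffOn_lUp i) u hu,
    hδ.mul h.contDiffOn_coeffB (hm i) u hu] at h1
  have h2 : ∀ j, hcov0 Φ (fun w => ∑ k, cfC Φ i j k w * mUp Φ k w) u = _ :=
    fun j => hδ.sum_mul (fun k => hC i j k) hm hu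
  have p0 := h.cfC_mUp_mUp hu 0
  have p1 := h.cfC_mUp_mUp hu 1
  have p := h.cfC_mUp_mUp hu i
  have t := h.radialL_trace hu
  simp only [h2] at h1
  simp only [h.hcov0_mUp hu, h.hcov0_lUp hu, covC, Fin.sum_univ_two] at h1 p0 p1 p ⊢
  -- The Γ-terms of the frame cancel those in `covC`; only the trace terms from the drift of m
  -- remain, and `t` rewrites them.
  linear_combination h1 + radialL Φ i 0 u * p0 + radialL Φ i 1 u * p1
    - (radialL Φ 0 0 u + radialL Φ 1 1 u) * p
    - (coeffA Φ u * lUp Φ i u + coeffB Φ u / 2 * mUp Φ i u) * t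

/-- The symmetric contraction of `N - Nᶜ` with `C`, evaluated on `m`. -/
theorem diffN_cfC_mUp_mUp (h : IsLocalFinsler Φ V) (hu : u ∈ V) (i : Fin 2) :
    ∑ j, (∑ k, (∑ p, (diffN Φ p k u * cfC Φ i j p u + diffN Φ p j u * cfC Φ i k p u))
        * mUp Φ k u) * mUp Φ j u
      = (Φ u : ℂ) * (coeffE Φ u - coeffY Φ u)
        * (coeffA Φ u * lUp Φ i u + coeffB Φ u * mUp Φ i u) := by
  have h0 := h.cfC_mUp hu i 0
  have h1 := h.cfC_mUp hu i 1
  have h2 := h.mDown_diffN_mUp hu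
  simp only [Fin.sum_univ_two] at h0 h1 h2 ⊢
  -- On (m, m) the two summands coincide; the resulting 2 cancels the ½ in `h2`.
  linear_combination
    2 * (diffN Φ 0 0 u * mUp Φ 0 u + diffN Φ 0 1 u * mUp Φ 1 u) * h0
    + 2 * (diffN Φ 1 0 u * mUp Φ 0 u + diffN Φ 1 1 u * mUp Φ 1 u) * h1
    + 2 * (coeffA Φ u * lUp Φ i u + coeffB Φ u * mUp Φ i u) * h2

/-- A symmetric form that annihilates `η` and vanishes on `m` is zero. -/
theorem eq_zero_of_mUp_mUp (h : IsLocalFinsler Φ V) (hu : u ∈ V) {W : Fin 2 → Fin 2 → ℂ}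
    (hs : ∀ j k, W j k = W k j) (hη : ∀ k, ∑ j, u.2 j * W j k = 0)
    (hm : ∑ j, (∑ k, W j k * mUp Φ k u) * mUp Φ j u = 0) (j k : Fin 2) : W j k = 0 := by
  have hl : ∀ j, ∑ k, W j k * lUp Φ k u = 0 := fun j => by
    apply mul_left_cancel₀ (h.norm_ne_zero hu)
    rw [mul_zero, ← hη j, Finset.mul_sum]
    exact Finset.sum_congr rfl fun p _ => by rw [← h.norm_mul_lUp hu, hs j p]; ring
  have h1 : ∀ j k, W j k = (∑ p, W j p * mUp Φ p u) * mDown Φ k u := fun j k => by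
    rw [h.covector_eq hu (W j) k, hl, zero_mul, zero_add]
  -- Each row of W is a multiple of m_k. By symmetry the vector of multiples is itself a multiple of
  -- m_j, and the last coefficient is the value on (m, m).
  have h2 : ∑ p, W j p * mUp Φ p u
      = (∑ q, (∑ p, W q p * mUp Φ p u) * mUp Φ q u) * mDown Φ j u := by
    rw [Finset.sum_mul]
    refine Finset.sum_congr rfl fun p _ => ?_
    rw [hs j p, h1 p j]; ring
  rw [h1, h2, hm, zero_mul, zero_mul]

theorem vector_eq_iff (h : IsLocalFinsler Φ V) (hu : u ∈ V) (a b a' b' : ℂ) :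
    (∀ i, a * lUp Φ i u + b * mUp Φ i u = a' * lUp Φ i u + b' * mUp Φ i u)
      ↔ a = a' ∧ b = b' := by
  refine ⟨fun hi => ⟨?_, ?_⟩, by rintro ⟨rfl, rfl⟩ i; rfl⟩
  · linear_combination lDown Φ 0 u * hi 0 + lDown Φ 1 u * hi 1
      + (a' - a) * h.lDown_lUp hu + (b' - b) * h.lDown_mUp hu
  · linear_combination mDown Φ 0 u * hi 0 + mDown Φ 1 u * hi 1
      + (a' - a) * h.mDown_lUp hu + (b' - b) * h.mDown_mUp hu

/-- The pointwise form of the characterization of Landsberg metrics. -/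
theorem berwaldL_eq_rundL_iff_frame (h : IsLocalFinsler Φ V) (hu : u ∈ V) :
    (∀ i j k, berwaldL Φ i j k u = rundL Φ i j k u) ↔
      (Φ u : ℂ) * coeffA Φ u * (coeffE Φ u - coeffY Φ u)
          = hcov0 Φ (coeffA Φ) u - (Φ u : ℂ) * coeffA Φ u * (coeffJ Φ u + coeffY Φ u) ∧
        (Φ u : ℂ) * coeffB Φ u * (coeffE Φ u - coeffY Φ u)
          = hcov0 Φ (coeffB Φ) u - (Φ u : ℂ) * coeffB Φ u / 2 * (coeffJ Φ u + coeffY Φ u) := by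
  simp only [h.berwaldL_eq_rundL_iff hu, h.sum_eta_dEta_cfL hu]
  rw [← h.vector_eq_iff hu]
  have hS : ∀ i, (Φ u : ℂ) * coeffA Φ u * (coeffE Φ u - coeffY Φ u) * lUp Φ i u
      + (Φ u : ℂ) * coeffB Φ u * (coeffE Φ u - coeffY Φ u) * mUp Φ i u = _ := fun i =>
    Eq.trans (by ring) (h.diffN_cfC_mUp_mUp hu i).symm
  simp only [hS, ← h.covC_mUp_mUp hu]
  refine ⟨fun hT i => by simp only [hT], fun hT i j k => ?_⟩
  -- For the converse, the difference of the two tensors is symmetric, annihilates η and vanishes on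
  -- (m, m).
  refine sub_eq_zero.1 (h.eq_zero_of_mUp_mUp hu (W := fun j k => covC Φ i j k u
    - ∑ p, (diffN Φ p k u * cfC Φ i j p u + diffN Φ p j u * cfC Φ i k p u))
    (fun j k => ?_) (fun k => ?_) ?_ j k)
  · simp only [h.covC_symm hu i j k, add_comm]
  · have e1 := h.sum_eta_covC hu i k
    have e2 := h.sum_eta_cfC hu i
    have e3 := h.sum_diffN_eta hu
    have e20 := e2 0
    have e21 := e2 1
    have e30 := e3 0
    have e31 := e3 1
    simp only [Fin.sum_univ_two] at e1 e20 e21 e30 e31 ⊢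
    linear_combination e1 - diffN Φ 0 k u * e20 - diffN Φ 1 k u * e21
      - cfC Φ i k 0 u * e30 - cfC Φ i k 1 u * e31
  · simp only [sub_mul, Finset.sum_sub_distrib, hT i, sub_self]

end Frame

end IsLocalFinsler

/-! ### Passage from the manifold to charts -/

theorem IsComplexFinsler.isLocalFinsler {n : ℕ} {M : Type*} [TopologicalSpace M]
    [ChartedSpace (Coord n) M] [IsManifold 𝓘(ℂ, Coord n) ω M]
    {F : TangentBundle 𝓘(ℂ, Coord n) M → ℝ} (hF : IsComplexFinsler F)
    {e : OpenPartialHomeomorph M (Coord n)}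
    (he : e ∈ IsManifold.maximalAtlas 𝓘(ℂ, Coord n) ω M) :
    IsLocalFinsler (localExpr F e) (slitDomain e) where
  isOpen := (e.open_target.preimage continuous_fst).inter (isOpen_ne_fun continuous_snd
    continuous_const)
  smooth := hF.smooth e he
  nonneg _ := hF.nonneg _
  homogeneous z η c := by
    simp only [localExpr]
    rw [← hF.homogeneous]
    congr 2
    -- Homogeneity in coordinates follows from the complex linearity of the differential of the
    -- inverse chart.
    exact map_smul (mfderiv 𝓘(ℂ, Coord n) 𝓘(ℂ, Coord n) e.symm z) c η
  ne_zero _ hu := hu.2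
  posDef := hF.posDef e he

end ComplexFinsler

theorem theorem4p6 {M : Type*} [TopologicalSpace M]
    [ChartedSpace (Coord 2) M]
    [IsManifold 𝓘(ℂ, Coord 2) ω M]
    (F : TangentBundle 𝓘(ℂ, Coord 2) M → ℝ)
    (hF : IsComplexFinsler F) :
    IsLandsberg F ↔
      ∀ e ∈ IsManifold.maximalAtlas 𝓘(ℂ, Coord 2) ω M,
        ∀ u ∈ slitDomain e,
          (localExpr F e u : ℂ)
                * coeffA (localExpr F e) u
                * (coeffE (localExpr F e) u
                  - coeffY (localExpr F e) u)
              = hcov0 (localExpr F e)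
                  (coeffA (localExpr F e)) u
                - (localExpr F e u : ℂ)
                  * coeffA (localExpr F e) u
                  * (coeffJ (localExpr F e) u
                    + coeffY (localExpr F e) u)
            ∧
          (localExpr F e u : ℂ)
                * coeffB (localExpr F e) u
                * (coeffE (localExpr F e) u
                  - coeffY (localExpr F e) u)
              = hcov0 (localExpr F e)
                  (coeffB (localExpr F e)) u
                - (localExpr F e u : ℂ)
                  * coeffB (localExpr F e) u / 2
                  * (coeffJ (localExpr F e) u
                    + coeffY (localExpr F e) u) :=
  forall₂_congr fun _ he => forall₂_congr fun _ hu =>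
    (hF.isLocalFinsler he).berwaldL_eq_rundL_iff_frame hu
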